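/- **Definitions.** A *birestriction monoid* is an algebra $(S;\cdot,{}^*,{}^+,1)$ such that $(S;\cdot,1)$ is a monoid and the identities $xx^*=x$, $x^*y^*=y^*x^*$, $(xy^*)^*=x^*y^*$, $x^*y=y(xy)^*$; $x^+x=x$, $x^+y^+=y^+x^+$, $(x^+y)^+=x^+y^+$, $xy^+=(xy)^+x$; $(x^+)^*=x^+$, $(x^*)^+=x^*$ hold. Its *projections* are the elements $s^*$ ($s\in S$); $s\le t$ means $s=et$ for some projection $e$; $\sigma$ is the minimum congruence identifying all the projections. $S$ is *$F$-birestriction* if every $\sigma$-class has a maximum element; $\mathfrak m(s)$ denotes the maximum element of the $\sigma$-class of $s$, and $F$-birestriction monoids are regarded as algebras of signature $(\cdot,{}^*,{}^+,\mathfrak m,1)$. Let $\mathsf{FFBR}(X)$ be the free $X$-generated $F$-birestriction monoid. Every inverse monoid is a birestriction monoid with $x^*=x^{-1}x$ and $x^+=xx^{-1}$. Let $X$ be a non-empty set, $X^*$ the free monoid and $X^+$ the free semigroup on $X$, and let $\overline{X^+}=\{\overline u: u\in X^+\}$ be a disjoint copy of $X^+$. Let $\mathcal F$ be the birestriction monoid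 generated by $X\cup\overline{X^+}$ subject to the relations $$x=\overline{x}\,x^*\ (x\in X),\qquad \overline u\,\overline v=\overline{uv}\,(\overline u\,\overline v)^*\ (u,v\in X^+),$$ and let $\mathcal I$ be the universal inverse monoid of $\mathcal F$, that is, the inverse monoid generated by $X\cup\overline{X^+}$ subject to the same relations, where $t^*$ is read as $t^{-1}t$. Put $\overline 1=1$. Let $E(\mathcal I)$ be the semilattice of idempotents of $\mathcal I$. The monoid $X^*$ acts partially on $E(\mathcal I)$ by the order isomorphisms between order ideals $$\varphi_u\colon\{e: e\le\overline u^*\}\to\{e: e\le\overline u^+\},\quad \varphi_u(e)=(\overline u e)^+,\quad \varphi_u^{-1}(e)=(e\overline u)^*\qquad(u\in X^*).$$ The *partial action product* $E(\mathcal I)\rtimes X^*$ is the set $\{(e,u)\in E(\mathcal I)\times X^*: e\in\operatorname{ran}\varphi_u\}$ with identity element $(1,1)$ and operations $(e,u)(f,v)=(\varphi_u(\varphi_u^{-1}(e)\wedge f),uv)$, $(e,u)^*=(\varphi_u^{-1}(e),1)$, $(e,u)^+=(e,1)$; it is a birestriction monoid. **Theorem.** Let $X$ be a non-empty set. Then $E(\mathcal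 I)\rtimes X^*$ is an $F$-birestriction monoid, and the map $x\mapsto(x^+,x)$, $x\in X$, extends to an isomorphism $$\mathsf{FFBR}(X)\simeq E(\mathcal I)\rtimes X^*$$ of $F$-birestriction monoids, that is, to a bijection preserving $\cdot$, ${}^*$, ${}^+$, $\mathfrak m$ and $1$. In detail, $$E(\mathcal I)\rtimes X^*=\{(e,u)\in E(\mathcal I)\times X^*: e\le\overline u^+\},$$ its identity element is $(1,1)$, and its remaining operations are given by $$(e,u)(f,v)=(e(\overline u f)^+,uv),\quad (e,u)^*=((e\overline u)^*,1),\quad (e,u)^+=(e,1),\quad \mathfrak m(e,u)=(\overline u^+,u).$$ -/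

import Mathlib

universe u v

namespace FBirestr

/-! ### Birestriction monoids -/

/-- A birestriction monoid, as an algebra of signature `(·, *, +, 1)`: `rStar x` is `x^*` and
`rPlus x` is `x^+`. The first four identities are those of restriction semigroups, the next four
those of corestriction semigroups, the last two connect `*` and `+`. -/
class BirestrictionMonoid (S : Type u) extends Monoid S where
  rStar : S → S
  rPlus : S → S
  mul_rStar : ∀ x : S, x * rStar x = x
  rStar_comm : ∀ x y : S, rStar x * rStar y = rStar y * rStar x
  rStar_mul_rStar : ∀ x y : S, rStar (x * rStar y) = rStar x * rStar y
  rStar_mul : ∀ x y : S, rStar x * y = y * rStar (x * y)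
  rPlus_mul : ∀ x : S, rPlus x * x = x
  rPlus_comm : ∀ x y : S, rPlus x * rPlus y = rPlus y * rPlus x
  rPlus_rPlus_mul : ∀ x y : S, rPlus (rPlus x * y) = rPlus x * rPlus y
  mul_rPlus : ∀ x y : S, x * rPlus y = rPlus (x * y) * x
  rStar_rPlus : ∀ x : S, rStar (rPlus x) = rPlus x
  rPlus_rStar : ∀ x : S, rPlus (rStar x) = rStar x

open BirestrictionMonoid (rStar rPlus mul_rStar rStar_comm rStar_mul_rStar rStar_mul rPlus_mul
  rPlus_comm rPlus_rPlus_mul mul_rPlus rStar_rPlus rPlus_rStar)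

/-- A morphism of birestriction monoids, that is, a `(2,1,1,0)`-morphism. -/
structure IsBirestrictionHom {S : Type u} {T : Type v} [BirestrictionMonoid S]
    [BirestrictionMonoid T] (f : S → T) : Prop where
  map_one : f 1 = 1
  map_mul : ∀ a b, f (a * b) = f a * f b
  map_rStar : ∀ a, f (rStar a) = rStar (f a)
  map_rPlus : ∀ a, f (rPlus a) = rPlus (f a)

section Basic

variable {S : Type u} [BirestrictionMonoid S]

/-- The projections of `S`: the elements of the form `s^*`, equivalently of the form `s^+`. -/
def IsProj (e : S) : Prop := ∃ s : S, rStar s = e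

/-- The natural partial order: `s ≤ t` iff `s = et` for some projection `e`. -/
def NatLE (s t : S) : Prop := ∃ e : S, IsProj e ∧ s = e * t

variable (S) in
/-- The minimum congruence `σ` that identifies all the projections. (A multiplicative congruence
that identifies all the projections respects `*` and `+`.) -/
def sigma : Con S := conGen fun a b => IsProj a ∧ IsProj b

/-- `m` is the maximum element of the `σ`-class of `s` for the natural partial order. -/
def IsMaxOfClass (s m : S) : Prop := sigma S s m ∧ ∀ t : S, sigma S s t → NatLE t m

variable (S) in
/-- `S` is `F`-birestriction: every `σ`-class has a maximum element. -/
def IsFBirestriction : Prop := ∀ s : S, ∃ m : S, IsMaxOfClass s m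

/-- The operation on an `F`-birestriction monoid that sends `s` to the maximum element of the
`σ`-class of `s`. -/
noncomputable def IsFBirestriction.max (h : IsFBirestriction S) (s : S) : S := (h s).choose

theorem isProj_rStar (s : S) : IsProj (rStar s) := ⟨s, rfl⟩

theorem isProj_rPlus (s : S) : IsProj (rPlus s) := ⟨rPlus s, rStar_rPlus s⟩

theorem IsProj.rStar_eq {e : S} (he : IsProj e) : rStar e = e := by
  obtain ⟨s, rfl⟩ := he
  rw [← rPlus_rStar s, rStar_rPlus]

theorem IsProj.comm {e f : S} (he : IsProj e) (hf : IsProj f) : e * f = f * e := by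
  obtain ⟨s, rfl⟩ := he
  obtain ⟨t, rfl⟩ := hf
  exact rStar_comm s t

theorem IsProj.mul {e f : S} (he : IsProj e) (hf : IsProj f) : IsProj (e * f) := by
  obtain ⟨s, rfl⟩ := he
  obtain ⟨t, rfl⟩ := hf
  exact ⟨s * rStar t, rStar_mul_rStar s t⟩

theorem IsProj.mul_eq {e : S} (he : IsProj e) (y : S) : e * y = y * rStar (e * y) := by
  have h := rStar_mul e y
  rwa [he.rStar_eq] at h

theorem IsProj.idem {e : S} (he : IsProj e) : e * e = e := by
  have h := mul_rStar e
  rwa [he.rStar_eq] at h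

theorem isProj_one : IsProj (1 : S) := ⟨1, by simpa using mul_rStar (1 : S)⟩

theorem sigma_iff {a b : S} : sigma S a b ↔ ∃ e : S, IsProj e ∧ a * e = b * e := by
  constructor
  · intro h
    let c : Con S :=
      { r := fun a b => ∃ e : S, IsProj e ∧ a * e = b * e
        iseqv := by
          refine ⟨fun a => ⟨1, isProj_one, rfl⟩, ?_, ?_⟩
          · rintro a b ⟨e, he, h⟩
            exact ⟨e, he, h.symm⟩
          · rintro a b c ⟨e, he, h⟩ ⟨f, hf, h'⟩
            refine ⟨e * f, he.mul hf, ?_⟩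
            rw [← mul_assoc, h, mul_assoc, he.comm hf, ← mul_assoc, h', mul_assoc]
        mul' := by
          rintro a b c d ⟨e, he, h⟩ ⟨f, hf, h'⟩
          refine ⟨f * rStar (e * c), hf.mul (isProj_rStar _), ?_⟩
          have h1 : c * (f * rStar (e * c)) = e * c * f := by
            rw [hf.comm (isProj_rStar _), ← mul_assoc, ← he.mul_eq]
          have h2 : d * (f * rStar (e * c)) = e * c * f := by
            rw [← h1, ← mul_assoc, ← h', mul_assoc]
          rw [mul_assoc, h1, mul_assoc b, h2, mul_assoc e, ← mul_assoc a, ← mul_assoc b, h] }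
    have hle : sigma S ≤ c := Con.conGen_le.2 fun x y hxy =>
      ⟨x * y, hxy.1.mul hxy.2, by
        rw [← mul_assoc, hxy.1.idem, hxy.1.comm hxy.2, ← mul_assoc, hxy.2.idem]⟩
    exact hle h
  · rintro ⟨e, he, h⟩
    have h1 : sigma S e 1 := ConGen.Rel.of _ _ ⟨he, isProj_one⟩
    have ha : sigma S (a * e) (a * 1) := (sigma S).mul ((sigma S).refl a) h1
    have hb : sigma S (b * e) (b * 1) := (sigma S).mul ((sigma S).refl b) h1
    rw [mul_one] at ha hb
    rw [h] at ha
    exact (sigma S).trans ((sigma S).symm ha) hb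

theorem NatLE.eq_mul_rStar {s t : S} (h : NatLE s t) : s = t * rStar s := by
  obtain ⟨e, he, rfl⟩ := h
  exact he.mul_eq t

theorem natLE_of_eq_mul {s t f : S} (hf : IsProj f) (h : s = t * f) : NatLE s t := by
  refine ⟨rPlus (t * f), isProj_rPlus _, ?_⟩
  obtain ⟨x, rfl⟩ := hf
  have h1 := mul_rPlus t (rStar x)
  rw [rPlus_rStar] at h1
  exact h.trans h1

theorem NatLE.antisymm {s t : S} (h : NatLE s t) (h' : NatLE t s) : s = t := by
  have h1 := h.eq_mul_rStar
  have h2 := h'.eq_mul_rStar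
  calc s = t * rStar s := h1
    _ = s * rStar t * rStar s := by rw [← h2]
    _ = s * rStar s * rStar t := by rw [mul_assoc, rStar_comm, ← mul_assoc]
    _ = t := by rw [mul_rStar, ← h2]

theorem IsMaxOfClass.unique {s t m n : S} (hm : IsMaxOfClass s m) (hn : IsMaxOfClass t n)
    (h : sigma S s t) : m = n :=
  (hn.2 m ((sigma S).trans ((sigma S).symm h) hm.1)).antisymm
    (hm.2 n ((sigma S).trans h hn.1))

end Basic

/-! ### `F`-birestriction monoids and the free one -/

/-- An `F`-birestriction monoid, as an algebra of signature `(·, *, +, mx, 1)`: the operation `mx`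
sends `a` to the maximum element of the `σ`-class of `a`. -/
class FBirestrictionMonoid (S : Type u) extends BirestrictionMonoid S where
  mx : S → S
  isMax_mx : ∀ a : S, IsMaxOfClass a (mx a)

open FBirestrictionMonoid (mx isMax_mx)

section Variety

variable {S : Type u} [FBirestrictionMonoid S]

theorem mx_mul_rStar (a : S) : mx a * rStar a = a :=
  ((isMax_mx a).2 a ((sigma S).refl a)).eq_mul_rStar.symm

theorem mx_mul_rStar_right (a b : S) : mx (a * rStar b) = mx a :=
  (isMax_mx _).unique (isMax_mx _) (sigma_iff.2 ⟨rStar b, isProj_rStar b, by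
    rw [mul_assoc, (isProj_rStar b).idem]⟩)

end Variety

/-- Terms over `X` in the signature `(·, *, +, mx, 1)`. -/
inductive FTerm (X : Type u) : Type u
  | var : X → FTerm X
  | one : FTerm X
  | mul : FTerm X → FTerm X → FTerm X
  | star : FTerm X → FTerm X
  | plus : FTerm X → FTerm X
  | max : FTerm X → FTerm X

/-- The fully invariant congruence of the variety of `F`-birestriction monoids: the least
congruence on terms containing all instances of the identities of birestriction monoids and of
`mx x * x^* = x` and `mx (x * y^*) = mx x`. -/
inductive FTerm.Rel {X : Type u} : FTerm X → FTerm X → Prop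
  | refl (a : FTerm X) : Rel a a
  | symm {a b : FTerm X} : Rel a b → Rel b a
  | trans {a b c : FTerm X} : Rel a b → Rel b c → Rel a c
  | mul {a b c d : FTerm X} : Rel a b → Rel c d → Rel (a.mul c) (b.mul d)
  | star {a b : FTerm X} : Rel a b → Rel a.star b.star
  | plus {a b : FTerm X} : Rel a b → Rel a.plus b.plus
  | max {a b : FTerm X} : Rel a b → Rel a.max b.max
  | mul_assoc (a b c : FTerm X) : Rel ((a.mul b).mul c) (a.mul (b.mul c))
  | one_mul (a : FTerm X) : Rel (one.mul a) a
  | mul_one (a : FTerm X) : Rel (a.mul one) a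
  | mul_rStar (a : FTerm X) : Rel (a.mul a.star) a
  | rStar_comm (a b : FTerm X) : Rel (a.star.mul b.star) (b.star.mul a.star)
  | rStar_mul_rStar (a b : FTerm X) : Rel (a.mul b.star).star (a.star.mul b.star)
  | rStar_mul (a b : FTerm X) : Rel (a.star.mul b) (b.mul (a.mul b).star)
  | rPlus_mul (a : FTerm X) : Rel (a.plus.mul a) a
  | rPlus_comm (a b : FTerm X) : Rel (a.plus.mul b.plus) (b.plus.mul a.plus)
  | rPlus_rPlus_mul (a b : FTerm X) : Rel (a.plus.mul b).plus (a.plus.mul b.plus)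
  | mul_rPlus (a b : FTerm X) : Rel (a.mul b.plus) ((a.mul b).plus.mul a)
  | rStar_rPlus (a : FTerm X) : Rel a.plus.star a.plus
  | rPlus_rStar (a : FTerm X) : Rel a.star.plus a.star
  | mx_mul_rStar (a : FTerm X) : Rel (a.max.mul a.star) a
  | mx_mul_rStar_right (a b : FTerm X) : Rel (a.mul b.star).max a.max

/-- The setoid of `FTerm.Rel`. -/
def FTerm.setoid (X : Type u) : Setoid (FTerm X) :=
  ⟨FTerm.Rel, FTerm.Rel.refl, FTerm.Rel.symm, FTerm.Rel.trans⟩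

/-- The free `X`-generated `F`-birestriction monoid `FFBR(X)`. -/
def FFBR (X : Type u) : Type u := Quotient (FTerm.setoid X)

namespace FFBR

variable {X : Type u}

/-- The class of a term in `FFBR(X)`. -/
def mk (t : FTerm X) : FFBR X := Quotient.mk (FTerm.setoid X) t

/-- The generators of `FFBR(X)`. -/
def of (x : X) : FFBR X := mk (FTerm.var x)

theorem ind {p : FFBR X → Prop} (h : ∀ t, p (mk t)) (a : FFBR X) : p a := Quotient.ind h a

theorem mk_eq {s t : FTerm X} (h : FTerm.Rel s t) : mk s = mk t :=
  Quotient.sound (s := FTerm.setoid X) h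

instance : BirestrictionMonoid (FFBR X) where
  mul := Quotient.map₂ FTerm.mul fun _ _ h _ _ h' => FTerm.Rel.mul h h'
  one := mk FTerm.one
  rStar := Quotient.map FTerm.star fun _ _ h => FTerm.Rel.star h
  rPlus := Quotient.map FTerm.plus fun _ _ h => FTerm.Rel.plus h
  mul_assoc := ind fun a => ind fun b => ind fun c => mk_eq (.mul_assoc a b c)
  one_mul := ind fun a => mk_eq (.one_mul a)
  mul_one := ind fun a => mk_eq (.mul_one a)
  mul_rStar := ind fun a => mk_eq (.mul_rStar a)
  rStar_comm := ind fun a => ind fun b => mk_eq (.rStar_comm a b)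
  rStar_mul_rStar := ind fun a => ind fun b => mk_eq (.rStar_mul_rStar a b)
  rStar_mul := ind fun a => ind fun b => mk_eq (.rStar_mul a b)
  rPlus_mul := ind fun a => mk_eq (.rPlus_mul a)
  rPlus_comm := ind fun a => ind fun b => mk_eq (.rPlus_comm a b)
  rPlus_rPlus_mul := ind fun a => ind fun b => mk_eq (.rPlus_rPlus_mul a b)
  mul_rPlus := ind fun a => ind fun b => mk_eq (.mul_rPlus a b)
  rStar_rPlus := ind fun a => mk_eq (.rStar_rPlus a)
  rPlus_rStar := ind fun a => mk_eq (.rPlus_rStar a)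

/-- The operation `mx` of `FFBR(X)`. -/
def mxOp : FFBR X → FFBR X := Quotient.map FTerm.max fun _ _ h => FTerm.Rel.max h

theorem mxOp_mul_rStar : ∀ a : FFBR X, mxOp a * rStar a = a :=
  ind fun a => mk_eq (.mx_mul_rStar a)

theorem mxOp_mul_rStar_right : ∀ a b : FFBR X, mxOp (a * rStar b) = mxOp a :=
  ind fun a => ind fun b => mk_eq (.mx_mul_rStar_right a b)

theorem mxOp_isMax (a : FFBR X) : IsMaxOfClass a (mxOp a) := by
  refine ⟨sigma_iff.2 ⟨rStar a, isProj_rStar a, ?_⟩, fun t ht => ?_⟩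
  · rw [mxOp_mul_rStar, mul_rStar]
  · obtain ⟨e, ⟨s, rfl⟩, h⟩ := sigma_iff.1 ht
    have h' : mxOp a = mxOp t := by
      rw [← mxOp_mul_rStar_right a s, h, mxOp_mul_rStar_right]
    rw [h']
    exact natLE_of_eq_mul (isProj_rStar t) (mxOp_mul_rStar t).symm

instance : FBirestrictionMonoid (FFBR X) where
  mx := mxOp
  isMax_mx := mxOp_isMax

end FFBR

/-- The value of a term in an `F`-birestriction monoid under an assignment of the variables. -/
def FTerm.eval {X : Type u} {S : Type v} [FBirestrictionMonoid S] (i : X → S) : FTerm X → S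
  | var x => i x
  | one => 1
  | mul a b => a.eval i * b.eval i
  | star a => rStar (a.eval i)
  | plus a => rPlus (a.eval i)
  | max a => mx (a.eval i)

theorem FTerm.Rel.eval_eq {X : Type u} {S : Type v} [FBirestrictionMonoid S] (i : X → S)
    {a b : FTerm X} (h : FTerm.Rel a b) : a.eval i = b.eval i := by
  induction h with
  | refl a => rfl
  | symm _ ih => exact ih.symm
  | trans _ _ ih ih' => exact ih.trans ih'
  | mul _ _ ih ih' => simp only [FTerm.eval, ih, ih']
  | star _ ih => simp only [FTerm.eval, ih]
  | plus _ ih => simp only [FTerm.eval, ih]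
  | max _ ih => simp only [FTerm.eval, ih]
  | mul_assoc a b c => exact _root_.mul_assoc _ _ _
  | one_mul a => exact _root_.one_mul _
  | mul_one a => exact _root_.mul_one _
  | mul_rStar a => exact BirestrictionMonoid.mul_rStar _
  | rStar_comm a b => exact BirestrictionMonoid.rStar_comm _ _
  | rStar_mul_rStar a b => exact BirestrictionMonoid.rStar_mul_rStar _ _
  | rStar_mul a b => exact BirestrictionMonoid.rStar_mul _ _
  | rPlus_mul a => exact BirestrictionMonoid.rPlus_mul _
  | rPlus_comm a b => exact BirestrictionMonoid.rPlus_comm _ _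
  | rPlus_rPlus_mul a b => exact BirestrictionMonoid.rPlus_rPlus_mul _ _
  | mul_rPlus a b => exact BirestrictionMonoid.mul_rPlus _ _
  | rStar_rPlus a => exact BirestrictionMonoid.rStar_rPlus _
  | rPlus_rStar a => exact BirestrictionMonoid.rPlus_rStar _
  | mx_mul_rStar a => exact FBirestr.mx_mul_rStar _
  | mx_mul_rStar_right a b => exact FBirestr.mx_mul_rStar_right _ _

/-- The universal property of `FFBR(X)`: every map from `X` to an `F`-birestriction monoid extends
uniquely to a `(2,1,1,1,0)`-morphism from `FFBR(X)`. -/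
theorem FFBR.existsUnique_lift {X : Type u} {S : Type v} [FBirestrictionMonoid S] (i : X → S) :
    ∃! f : FFBR X → S, IsBirestrictionHom f ∧ (∀ a, f (mx a) = mx (f a)) ∧
      ∀ x, f (FFBR.of x) = i x := by
  refine ⟨Quotient.lift (FTerm.eval i) fun _ _ h => FTerm.Rel.eval_eq i h,
    ⟨⟨rfl, FFBR.ind fun _ => FFBR.ind fun _ => rfl, FFBR.ind fun _ => rfl,
      FFBR.ind fun _ => rfl⟩, FFBR.ind fun _ => rfl, fun _ => rfl⟩, ?_⟩
  rintro g ⟨hg, hmx, hi⟩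
  funext a
  induction a using FFBR.ind with | h t =>
  change g (FFBR.mk t) = t.eval i
  induction t with
  | var x => exact hi x
  | one => exact hg.map_one
  | mul a b iha ihb =>
    exact (hg.map_mul (FFBR.mk a) (FFBR.mk b)).trans (by rw [iha, ihb]; rfl)
  | star a ih => exact (hg.map_rStar (FFBR.mk a)).trans (by rw [ih]; rfl)
  | plus a ih => exact (hg.map_rPlus (FFBR.mk a)).trans (by rw [ih]; rfl)
  | max a ih => exact (hmx (FFBR.mk a)).trans (by rw [ih]; rfl)

/-! ### Presentations of birestriction monoids -/

/-- Terms over `Y` in the signature `(·, *, +, 1)`. -/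
inductive BTerm (Y : Type u) : Type u
  | var : Y → BTerm Y
  | one : BTerm Y
  | mul : BTerm Y → BTerm Y → BTerm Y
  | star : BTerm Y → BTerm Y
  | plus : BTerm Y → BTerm Y

/-- The least congruence on terms containing all instances of the identities of birestriction
monoids and the relations `R`. -/
inductive BTerm.Rel {Y : Type u} (R : BTerm Y → BTerm Y → Prop) : BTerm Y → BTerm Y → Prop
  | rel {a b : BTerm Y} : R a b → Rel R a b
  | refl (a : BTerm Y) : Rel R a a
  | symm {a b : BTerm Y} : Rel R a b → Rel R b a
  | trans {a b c : BTerm Y} : Rel R a b → Rel R b c → Rel R a c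
  | mul {a b c d : BTerm Y} : Rel R a b → Rel R c d → Rel R (a.mul c) (b.mul d)
  | star {a b : BTerm Y} : Rel R a b → Rel R a.star b.star
  | plus {a b : BTerm Y} : Rel R a b → Rel R a.plus b.plus
  | mul_assoc (a b c : BTerm Y) : Rel R ((a.mul b).mul c) (a.mul (b.mul c))
  | one_mul (a : BTerm Y) : Rel R (one.mul a) a
  | mul_one (a : BTerm Y) : Rel R (a.mul one) a
  | mul_rStar (a : BTerm Y) : Rel R (a.mul a.star) a
  | rStar_comm (a b : BTerm Y) : Rel R (a.star.mul b.star) (b.star.mul a.star)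
  | rStar_mul_rStar (a b : BTerm Y) : Rel R (a.mul b.star).star (a.star.mul b.star)
  | rStar_mul (a b : BTerm Y) : Rel R (a.star.mul b) (b.mul (a.mul b).star)
  | rPlus_mul (a : BTerm Y) : Rel R (a.plus.mul a) a
  | rPlus_comm (a b : BTerm Y) : Rel R (a.plus.mul b.plus) (b.plus.mul a.plus)
  | rPlus_rPlus_mul (a b : BTerm Y) : Rel R (a.plus.mul b).plus (a.plus.mul b.plus)
  | mul_rPlus (a b : BTerm Y) : Rel R (a.mul b.plus) ((a.mul b).plus.mul a)
  | rStar_rPlus (a : BTerm Y) : Rel R a.plus.star a.plus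
  | rPlus_rStar (a : BTerm Y) : Rel R a.star.plus a.star

/-- The setoid of `BTerm.Rel R`. -/
def BTerm.setoid {Y : Type u} (R : BTerm Y → BTerm Y → Prop) : Setoid (BTerm Y) :=
  ⟨BTerm.Rel R, BTerm.Rel.refl, BTerm.Rel.symm, BTerm.Rel.trans⟩

/-- The birestriction monoid `BRestr⟨Y | R⟩` generated by `Y` subject to the relations `R`. -/
def BRestr {Y : Type u} (R : BTerm Y → BTerm Y → Prop) : Type u := Quotient (BTerm.setoid R)

namespace BRestr

variable {Y : Type u} {R : BTerm Y → BTerm Y → Prop}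

/-- The class of a term in `BRestr⟨Y | R⟩`. -/
def mk (t : BTerm Y) : BRestr R := Quotient.mk (BTerm.setoid R) t

/-- The generators of `BRestr⟨Y | R⟩`. -/
def of (y : Y) : BRestr R := mk (BTerm.var y)

theorem ind {p : BRestr R → Prop} (h : ∀ t, p (mk t)) (a : BRestr R) : p a := Quotient.ind h a

theorem mk_eq {s t : BTerm Y} (h : BTerm.Rel R s t) : (mk s : BRestr R) = mk t :=
  Quotient.sound (s := BTerm.setoid R) h

instance : BirestrictionMonoid (BRestr R) where
  mul := Quotient.map₂ BTerm.mul fun _ _ h _ _ h' => BTerm.Rel.mul h h'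
  one := mk BTerm.one
  rStar := Quotient.map BTerm.star fun _ _ h => BTerm.Rel.star h
  rPlus := Quotient.map BTerm.plus fun _ _ h => BTerm.Rel.plus h
  mul_assoc := ind fun a => ind fun b => ind fun c => mk_eq (.mul_assoc a b c)
  one_mul := ind fun a => mk_eq (.one_mul a)
  mul_one := ind fun a => mk_eq (.mul_one a)
  mul_rStar := ind fun a => mk_eq (.mul_rStar a)
  rStar_comm := ind fun a => ind fun b => mk_eq (.rStar_comm a b)
  rStar_mul_rStar := ind fun a => ind fun b => mk_eq (.rStar_mul_rStar a b)
  rStar_mul := ind fun a => ind fun b => mk_eq (.rStar_mul a b)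
  rPlus_mul := ind fun a => mk_eq (.rPlus_mul a)
  rPlus_comm := ind fun a => ind fun b => mk_eq (.rPlus_comm a b)
  rPlus_rPlus_mul := ind fun a => ind fun b => mk_eq (.rPlus_rPlus_mul a b)
  mul_rPlus := ind fun a => ind fun b => mk_eq (.mul_rPlus a b)
  rStar_rPlus := ind fun a => mk_eq (.rStar_rPlus a)
  rPlus_rStar := ind fun a => mk_eq (.rPlus_rStar a)

end BRestr

/-! ### Inverse monoids -/

/-- Inverse monoids, by the usual identities in the signature `(·, ⁻¹, 1)`. -/
class InverseMonoid (S : Type u) extends Monoid S, Inv S where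
  inverse_inv : ∀ a : S, a⁻¹⁻¹ = a
  inverse_mul : ∀ a b : S, (a * b)⁻¹ = b⁻¹ * a⁻¹
  mul_inverse_mul : ∀ a : S, a * a⁻¹ * a = a
  inverse_comm : ∀ a b : S, a * a⁻¹ * (b * b⁻¹) = b * b⁻¹ * (a * a⁻¹)

open InverseMonoid (inverse_inv inverse_mul mul_inverse_mul inverse_comm)

section InverseBasic

variable {S : Type u} [InverseMonoid S]

theorem inverse_mul_inverse (a : S) : a⁻¹ * a * a⁻¹ = a⁻¹ := by
  have h := mul_inverse_mul a⁻¹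
  rwa [inverse_inv] at h

theorem idem_inverse_eq {e : S} (he : IsIdempotentElem e) : e⁻¹ = e := by
  have hp : (e * e⁻¹)⁻¹ = e * e⁻¹ := by rw [inverse_mul, inverse_inv]
  have hq : (e⁻¹ * e)⁻¹ = e⁻¹ * e := by rw [inverse_mul, inverse_inv]
  have hc := inverse_comm e e⁻¹
  rw [inverse_inv] at hc
  have h1 : e⁻¹ = e⁻¹ * e * (e * e⁻¹) := by
    calc e⁻¹ = e⁻¹ * e * e⁻¹ := (inverse_mul_inverse e).symm
      _ = e⁻¹ * (e * e) * e⁻¹ := by rw [he.eq]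
      _ = _ := by simp only [mul_assoc]
  have h2 : e = e * e⁻¹ * (e⁻¹ * e) := by
    calc e = e⁻¹⁻¹ := (inverse_inv e).symm
      _ = (e⁻¹ * e * (e * e⁻¹))⁻¹ := by rw [← h1]
      _ = _ := by rw [inverse_mul, hp, hq]
  rw [h1, ← hc, ← h2]

theorem idem_mul_inverse (a : S) : IsIdempotentElem (a * a⁻¹) := by
  change a * a⁻¹ * (a * a⁻¹) = a * a⁻¹
  rw [← mul_assoc, mul_inverse_mul]

theorem idem_inverse_mul (a : S) : IsIdempotentElem (a⁻¹ * a) := by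
  change a⁻¹ * a * (a⁻¹ * a) = a⁻¹ * a
  rw [← mul_assoc, inverse_mul_inverse]

theorem idem_comm {e f : S} (he : IsIdempotentElem e) (hf : IsIdempotentElem f) :
    e * f = f * e := by
  have h := inverse_comm e f
  rwa [idem_inverse_eq he, idem_inverse_eq hf, he.eq, hf.eq] at h

/-- An inverse monoid is a birestriction monoid with `x^* = x⁻¹x` and `x^+ = xx⁻¹`. -/
instance InverseMonoid.toBirestrictionMonoid : BirestrictionMonoid S where
  rStar x := x⁻¹ * x
  rPlus x := x * x⁻¹
  mul_rStar x := by rw [← mul_assoc, mul_inverse_mul]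
  rStar_comm x y := idem_comm (idem_inverse_mul x) (idem_inverse_mul y)
  rStar_mul_rStar x y := by
    have hy := idem_inverse_mul y
    rw [inverse_mul, idem_inverse_eq hy, mul_assoc, ← mul_assoc x⁻¹, ← mul_assoc,
      idem_comm hy (idem_inverse_mul x), mul_assoc, hy.eq]
  rStar_mul x y := by
    calc x⁻¹ * x * y = x⁻¹ * x * (y * y⁻¹ * y) := by rw [mul_inverse_mul]
      _ = x⁻¹ * x * (y * y⁻¹) * y := by simp only [mul_assoc]
      _ = y * y⁻¹ * (x⁻¹ * x) * y := by
        rw [idem_comm (idem_inverse_mul x) (idem_mul_inverse y)]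
      _ = y * ((x * y)⁻¹ * (x * y)) := by rw [inverse_mul]; simp only [mul_assoc]
  rPlus_mul x := mul_inverse_mul x
  rPlus_comm x y := idem_comm (idem_mul_inverse x) (idem_mul_inverse y)
  rPlus_rPlus_mul x y := by
    have hx := idem_mul_inverse x
    rw [inverse_mul, idem_inverse_eq hx, mul_assoc, ← mul_assoc y,
      idem_comm (idem_mul_inverse y) hx, ← mul_assoc, hx.eq]
  mul_rPlus x y := by
    calc x * (y * y⁻¹) = x * x⁻¹ * x * (y * y⁻¹) := by rw [mul_inverse_mul]
      _ = x * (x⁻¹ * x * (y * y⁻¹)) := by simp only [mul_assoc]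
      _ = x * (y * y⁻¹ * (x⁻¹ * x)) := by
        rw [idem_comm (idem_inverse_mul x) (idem_mul_inverse y)]
      _ = x * y * (x * y)⁻¹ * x := by rw [inverse_mul]; simp only [mul_assoc]
  rStar_rPlus x := by rw [idem_inverse_eq (idem_mul_inverse x), (idem_mul_inverse x).eq]
  rPlus_rStar x := by rw [idem_inverse_eq (idem_inverse_mul x), (idem_inverse_mul x).eq]

theorem rStar_def (a : S) : rStar a = a⁻¹ * a := rfl

theorem rPlus_def (a : S) : rPlus a = a * a⁻¹ := rfl

end InverseBasic

/-- The set `E(S)` of idempotents of an inverse monoid. -/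
@[ext]
structure Idem (S : Type u) [InverseMonoid S] : Type u where
  val : S
  idem : IsIdempotentElem val

namespace Idem

variable {S : Type u} [InverseMonoid S]

/-- `E(S)` is a semilattice with `e ∧ f = ef`, so that `e ≤ f` iff `ef = e`. -/
instance : SemilatticeInf (Idem S) where
  le e f := e.1 * f.1 = e.1
  le_refl e := e.2.eq
  le_trans e f g h h' := by
    rw [← h, mul_assoc, h']
  le_antisymm e f h h' := Idem.ext (by rw [← h, idem_comm e.2 f.2, h'])
  inf e f := ⟨e.1 * f.1, by
    change e.1 * f.1 * (e.1 * f.1) = e.1 * f.1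
    rw [mul_assoc, idem_comm f.2 (IsIdempotentElem.mul_of_commute (idem_comm e.2 f.2) e.2 f.2),
      mul_assoc, f.2.eq, ← mul_assoc, e.2.eq]⟩
  inf_le_left e f := by
    change e.1 * f.1 * e.1 = e.1 * f.1
    rw [idem_comm e.2 f.2, mul_assoc, e.2.eq]
  inf_le_right e f := by
    change e.1 * f.1 * f.1 = e.1 * f.1
    rw [mul_assoc, f.2.eq]
  le_inf e f g h h' := by
    change e.1 * (f.1 * g.1) = e.1
    rw [← mul_assoc, h, h']

instance : OrderTop (Idem S) where
  top := ⟨1, IsIdempotentElem.one⟩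
  le_top e := mul_one e.1

theorem le_iff {e f : Idem S} : e ≤ f ↔ e.1 * f.1 = e.1 := Iff.rfl

/-- `s^+` as an element of `E(S)`. -/
def plus (s : S) : Idem S := ⟨rPlus s, idem_mul_inverse s⟩

/-- `s^*` as an element of `E(S)`. -/
def star (s : S) : Idem S := ⟨rStar s, idem_inverse_mul s⟩

end Idem

/-! ### Presentations of inverse monoids -/

/-- Terms over `Y` in the signature `(·, ⁻¹, 1)`. -/
inductive ITerm (Y : Type u) : Type u
  | var : Y → ITerm Y
  | one : ITerm Y
  | mul : ITerm Y → ITerm Y → ITerm Y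
  | inv : ITerm Y → ITerm Y

/-- The least congruence on terms containing all instances of the identities of inverse monoids
and the relations `R`. -/
inductive ITerm.Rel {Y : Type u} (R : ITerm Y → ITerm Y → Prop) : ITerm Y → ITerm Y → Prop
  | rel {a b : ITerm Y} : R a b → Rel R a b
  | refl (a : ITerm Y) : Rel R a a
  | symm {a b : ITerm Y} : Rel R a b → Rel R b a
  | trans {a b c : ITerm Y} : Rel R a b → Rel R b c → Rel R a c
  | mul {a b c d : ITerm Y} : Rel R a b → Rel R c d → Rel R (a.mul c) (b.mul d)
  | inv {a b : ITerm Y} : Rel R a b → Rel R a.inv b.inv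
  | mul_assoc (a b c : ITerm Y) : Rel R ((a.mul b).mul c) (a.mul (b.mul c))
  | one_mul (a : ITerm Y) : Rel R (one.mul a) a
  | mul_one (a : ITerm Y) : Rel R (a.mul one) a
  | inverse_inv (a : ITerm Y) : Rel R a.inv.inv a
  | inverse_mul (a b : ITerm Y) : Rel R (a.mul b).inv (b.inv.mul a.inv)
  | mul_inverse_mul (a : ITerm Y) : Rel R ((a.mul a.inv).mul a) a
  | inverse_comm (a b : ITerm Y) :
      Rel R ((a.mul a.inv).mul (b.mul b.inv)) ((b.mul b.inv).mul (a.mul a.inv))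

/-- The setoid of `ITerm.Rel R`. -/
def ITerm.setoid {Y : Type u} (R : ITerm Y → ITerm Y → Prop) : Setoid (ITerm Y) :=
  ⟨ITerm.Rel R, ITerm.Rel.refl, ITerm.Rel.symm, ITerm.Rel.trans⟩

/-- The inverse monoid `Inv⟨Y | R⟩` generated by `Y` subject to the relations `R`. -/
def InvPres {Y : Type u} (R : ITerm Y → ITerm Y → Prop) : Type u := Quotient (ITerm.setoid R)

namespace InvPres

variable {Y : Type u} {R : ITerm Y → ITerm Y → Prop}

/-- The class of a term in `Inv⟨Y | R⟩`. -/
def mk (t : ITerm Y) : InvPres R := Quotient.mk (ITerm.setoid R) t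

/-- The generators of `Inv⟨Y | R⟩`. -/
def of (y : Y) : InvPres R := mk (ITerm.var y)

theorem ind {p : InvPres R → Prop} (h : ∀ t, p (mk t)) (a : InvPres R) : p a := Quotient.ind h a

theorem mk_eq {s t : ITerm Y} (h : ITerm.Rel R s t) : (mk s : InvPres R) = mk t :=
  Quotient.sound (s := ITerm.setoid R) h

instance : InverseMonoid (InvPres R) where
  mul := Quotient.map₂ ITerm.mul fun _ _ h _ _ h' => ITerm.Rel.mul h h'
  one := mk ITerm.one
  inv := Quotient.map ITerm.inv fun _ _ h => ITerm.Rel.inv h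
  mul_assoc := ind fun a => ind fun b => ind fun c => mk_eq (.mul_assoc a b c)
  one_mul := ind fun a => mk_eq (.one_mul a)
  mul_one := ind fun a => mk_eq (.mul_one a)
  inverse_inv := ind fun a => mk_eq (.inverse_inv a)
  inverse_mul := ind fun a => ind fun b => mk_eq (.inverse_mul a b)
  mul_inverse_mul := ind fun a => mk_eq (.mul_inverse_mul a)
  inverse_comm := ind fun a => ind fun b => mk_eq (.inverse_comm a b)

end InvPres

/-- The map `ψ` from birestriction terms to inverse monoid terms that is identical on generators,
with `t^* = t⁻¹t` and `t^+ = tt⁻¹`. -/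
def BTerm.toITerm {Y : Type u} : BTerm Y → ITerm Y
  | var y => .var y
  | one => .one
  | mul a b => .mul a.toITerm b.toITerm
  | star a => .mul (.inv a.toITerm) a.toITerm
  | plus a => .mul a.toITerm (.inv a.toITerm)

/-- The relations `ψ(R)`. -/
inductive ImageRel {Y : Type u} (R : BTerm Y → BTerm Y → Prop) : ITerm Y → ITerm Y → Prop
  | intro {a b : BTerm Y} : R a b → ImageRel R a.toITerm b.toITerm

/-- The universal inverse monoid `Inv⟨Y | ψ(R)⟩` of the birestriction monoid `BRestr⟨Y | R⟩`. -/
abbrev UniversalInverseMonoid {Y : Type u} (R : BTerm Y → BTerm Y → Prop) : Type u :=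
  InvPres (ImageRel R)

/-- The value of a birestriction term in a birestriction monoid. -/
def BTerm.eval {Y : Type u} {S : Type v} [BirestrictionMonoid S] (i : Y → S) : BTerm Y → S
  | var y => i y
  | one => 1
  | mul a b => a.eval i * b.eval i
  | star a => rStar (a.eval i)
  | plus a => rPlus (a.eval i)

/-- The value of an inverse monoid term in an inverse monoid. -/
def ITerm.eval {Y : Type u} {S : Type v} [InverseMonoid S] (i : Y → S) : ITerm Y → S
  | var y => i y
  | one => 1
  | mul a b => a.eval i * b.eval i
  | inv a => (a.eval i)⁻¹

theorem BTerm.toITerm_eval {Y : Type u} {S : Type v} [InverseMonoid S] (i : Y → S) (t : BTerm Y) :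
    t.toITerm.eval i = t.eval i := by
  induction t with
  | var y => rfl
  | one => rfl
  | mul a b iha ihb => simp only [BTerm.toITerm, ITerm.eval, BTerm.eval, iha, ihb]
  | star a ih => simp only [BTerm.toITerm, ITerm.eval, BTerm.eval, ih, rStar_def]
  | plus a ih => simp only [BTerm.toITerm, ITerm.eval, BTerm.eval, ih, rPlus_def]

theorem BTerm.Rel.eval_eq {Y : Type u} {S : Type v} [BirestrictionMonoid S] {i : Y → S}
    {R : BTerm Y → BTerm Y → Prop} (hR : ∀ a b, R a b → a.eval i = b.eval i)
    {a b : BTerm Y} (h : BTerm.Rel R a b) : a.eval i = b.eval i := by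
  induction h with
  | rel h => exact hR _ _ h
  | refl a => rfl
  | symm _ ih => exact ih.symm
  | trans _ _ ih ih' => exact ih.trans ih'
  | mul _ _ ih ih' => simp only [BTerm.eval, ih, ih']
  | star _ ih => simp only [BTerm.eval, ih]
  | plus _ ih => simp only [BTerm.eval, ih]
  | mul_assoc a b c => exact _root_.mul_assoc _ _ _
  | one_mul a => exact _root_.one_mul _
  | mul_one a => exact _root_.mul_one _
  | mul_rStar a => exact BirestrictionMonoid.mul_rStar _
  | rStar_comm a b => exact BirestrictionMonoid.rStar_comm _ _
  | rStar_mul_rStar a b => exact BirestrictionMonoid.rStar_mul_rStar _ _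
  | rStar_mul a b => exact BirestrictionMonoid.rStar_mul _ _
  | rPlus_mul a => exact BirestrictionMonoid.rPlus_mul _
  | rPlus_comm a b => exact BirestrictionMonoid.rPlus_comm _ _
  | rPlus_rPlus_mul a b => exact BirestrictionMonoid.rPlus_rPlus_mul _ _
  | mul_rPlus a b => exact BirestrictionMonoid.mul_rPlus _ _
  | rStar_rPlus a => exact BirestrictionMonoid.rStar_rPlus _
  | rPlus_rStar a => exact BirestrictionMonoid.rPlus_rStar _

theorem ITerm.Rel.eval_eq {Y : Type u} {S : Type v} [InverseMonoid S] {i : Y → S}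
    {R : ITerm Y → ITerm Y → Prop} (hR : ∀ a b, R a b → a.eval i = b.eval i)
    {a b : ITerm Y} (h : ITerm.Rel R a b) : a.eval i = b.eval i := by
  induction h with
  | rel h => exact hR _ _ h
  | refl a => rfl
  | symm _ ih => exact ih.symm
  | trans _ _ ih ih' => exact ih.trans ih'
  | mul _ _ ih ih' => simp only [ITerm.eval, ih, ih']
  | inv _ ih => simp only [ITerm.eval, ih]
  | mul_assoc a b c => exact _root_.mul_assoc _ _ _
  | one_mul a => exact _root_.one_mul _
  | mul_one a => exact _root_.mul_one _
  | inverse_inv a => exact InverseMonoid.inverse_inv _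
  | inverse_mul a b => exact InverseMonoid.inverse_mul _ _
  | mul_inverse_mul a => exact InverseMonoid.mul_inverse_mul _
  | inverse_comm a b => exact InverseMonoid.inverse_comm _ _

theorem BRestr.hom_mk {Y : Type u} {R : BTerm Y → BTerm Y → Prop} {S : Type v}
    [BirestrictionMonoid S] {g : BRestr R → S} (hg : IsBirestrictionHom g) (t : BTerm Y) :
    g (BRestr.mk t) = t.eval fun y => g (BRestr.of y) := by
  induction t with
  | var y => rfl
  | one => exact hg.map_one
  | mul a b iha ihb =>
    exact (hg.map_mul (BRestr.mk a) (BRestr.mk b)).trans (by rw [iha, ihb]; rfl)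
  | star a ih => exact (hg.map_rStar (BRestr.mk a)).trans (by rw [ih]; rfl)
  | plus a ih => exact (hg.map_rPlus (BRestr.mk a)).trans (by rw [ih]; rfl)

theorem InvPres.mk_toITerm {Y : Type u} {R : BTerm Y → BTerm Y → Prop} (t : BTerm Y) :
    (InvPres.mk t.toITerm : UniversalInverseMonoid R) = t.eval InvPres.of := by
  rw [← BTerm.toITerm_eval]
  generalize t.toITerm = s
  induction s with
  | var y => rfl
  | one => rfl
  | mul a b iha ihb => simp only [ITerm.eval, ← iha, ← ihb]; rfl
  | inv a ih => simp only [ITerm.eval, ← ih]; rfl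

/-- The canonical morphism `ψ` from `BRestr⟨Y | R⟩` to its universal inverse monoid. -/
def toUniversal {Y : Type u} (R : BTerm Y → BTerm Y → Prop) :
    BRestr R → UniversalInverseMonoid R :=
  Quotient.lift (BTerm.eval InvPres.of) fun _ _ h => BTerm.Rel.eval_eq (fun a b hab => by
    rw [← InvPres.mk_toITerm, ← InvPres.mk_toITerm]
    exact InvPres.mk_eq (ITerm.Rel.rel (ImageRel.intro hab))) h

theorem toUniversal_isHom {Y : Type u} (R : BTerm Y → BTerm Y → Prop) :
    IsBirestrictionHom (toUniversal R) where
  map_one := rfl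
  map_mul := BRestr.ind fun _ => BRestr.ind fun _ => rfl
  map_rStar := BRestr.ind fun _ => rfl
  map_rPlus := BRestr.ind fun _ => rfl

/-- The universal property of the universal inverse monoid: every morphism of birestriction monoids
from `BRestr⟨Y | R⟩` to an inverse monoid factors uniquely through it. -/
theorem existsUnique_factor {Y : Type u} {R : BTerm Y → BTerm Y → Prop} {T : Type v}
    [InverseMonoid T] {g : BRestr R → T} (hg : IsBirestrictionHom g) :
    ∃! h : UniversalInverseMonoid R → T, (h 1 = 1 ∧ (∀ a b, h (a * b) = h a * h b) ∧
      ∀ a, h a⁻¹ = (h a)⁻¹) ∧ ∀ a, h (toUniversal R a) = g a := by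
  have hR : ∀ a b, ImageRel R a b → a.eval (fun y => g (BRestr.of y)) =
      b.eval (fun y => g (BRestr.of y)) := by
    rintro _ _ ⟨hab⟩
    rw [BTerm.toITerm_eval, BTerm.toITerm_eval, ← BRestr.hom_mk hg, ← BRestr.hom_mk hg,
      BRestr.mk_eq (BTerm.Rel.rel hab)]
  refine ⟨Quotient.lift (ITerm.eval fun y => g (BRestr.of y)) fun _ _ h =>
    ITerm.Rel.eval_eq hR h, ⟨⟨rfl, InvPres.ind fun _ => InvPres.ind fun _ => rfl,
      InvPres.ind fun _ => rfl⟩, BRestr.ind fun t => ?_⟩, ?_⟩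
  · rw [BRestr.hom_mk hg, ← BTerm.toITerm_eval]
    change Quotient.lift _ _ (t.eval InvPres.of : UniversalInverseMonoid R) = _
    rw [← InvPres.mk_toITerm]
    rfl
  · rintro k ⟨⟨h1, h2, h3⟩, h4⟩
    funext a
    induction a using InvPres.ind with | h t =>
    change k (InvPres.mk t) = t.eval _
    induction t with
    | var y => exact h4 (BRestr.of y)
    | one => exact h1
    | mul a b iha ihb =>
      exact (h2 (InvPres.mk a) (InvPres.mk b)).trans (by rw [iha, ihb]; rfl)
    | inv a ih => exact (h3 (InvPres.mk a)).trans (by rw [ih]; rfl)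

/-! ### The birestriction monoid `ℱ` and its universal inverse monoid `ℐ` -/

/-- The extended set of generators `X ∪ X̄⁺`: `Sum.inl x` is `x`, and `Sum.inr u` is `ū`. -/
abbrev ExtGen (X : Type u) : Type u := X ⊕ FreeSemigroup X

/-- The relations `N`: `x̄ ≥ x`, that is, `x = x̄ x^*`, for `x ∈ X`, and `uv‾ ≥ ū v̄`, that is,
`ū v̄ = uv‾ (ū v̄)^*`, for `u, v ∈ X⁺`. -/
inductive RelN (X : Type u) : BTerm (ExtGen X) → BTerm (ExtGen X) → Prop
  | letter (x : X) :
      RelN X (.var (.inl x))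
        (.mul (.var (.inr (FreeSemigroup.of x))) (.star (.var (.inl x))))
  | word (s t : FreeSemigroup X) :
      RelN X (.mul (.var (.inr s)) (.var (.inr t)))
        (.mul (.var (.inr (s * t))) (.star (.mul (.var (.inr s)) (.var (.inr t)))))

/-- The birestriction monoid `ℱ = BRestr⟨X ∪ X̄⁺ | N⟩`. -/
abbrev MonF (X : Type u) : Type u := BRestr (RelN X)

/-- The universal inverse monoid `ℐ = Inv⟨X ∪ X̄⁺ | ψ(N)⟩` of `ℱ`. -/
abbrev MonI (X : Type u) : Type u := UniversalInverseMonoid (RelN X)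

/-- The generator `x` of `ℐ`. -/
def gen {X : Type u} (x : X) : MonI X := InvPres.of (.inl x)

/-- The element `ū` of `ℐ`, for `u ∈ X*`: the generator `ū` if `u ∈ X⁺`, and `1` if `u = 1`. -/
def bar {X : Type u} (w : FreeMonoid X) : MonI X :=
  match FreeMonoid.toList w with
  | [] => 1
  | x :: l => InvPres.of (.inr ⟨x, l⟩)

/-! ### Partial actions and partial action products -/

/-- A partial action of the monoid `M` on the semilattice `Y` by order isomorphisms between order
ideals, that is, a premorphism `φ` from `M` to the inverse monoid of all order isomorphisms
between (non-empty) order ideals of `Y`. -/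
structure PartialAction (M : Type u) (Y : Type v) [Monoid M] [SemilatticeInf Y] where
  /-- The partial bijection `φ_m`, with domain `source` and range `target`. -/
  act : M → PartialEquiv Y Y
  source_nonempty : ∀ m, (act m).source.Nonempty
  isLowerSet_source : ∀ m, IsLowerSet (act m).source
  isLowerSet_target : ∀ m, IsLowerSet (act m).target
  le_iff_le : ∀ m, ∀ a ∈ (act m).source, ∀ b ∈ (act m).source, act m a ≤ act m b ↔ a ≤ b
  one_source : (act 1).source = Set.univ
  one_act : ∀ a, act 1 a = a
  mul_source : ∀ m n, ∀ a ∈ (act n).source, act n a ∈ (act m).source → a ∈ (act (m * n)).source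
  mul_act : ∀ m n, ∀ a ∈ (act n).source, act n a ∈ (act m).source →
    act (m * n) a = act m (act n a)

namespace PartialAction

variable {M : Type u} {Y : Type v} [Monoid M] [SemilatticeInf Y] (φ : PartialAction M Y)

/-- The underlying set `{(e, m) ∈ Y × M | e ∈ ran φ_m}` of the partial action product. -/
def carrier : Set (Y × M) := {p | p.1 ∈ (φ.act p.2).target}

/-- The partial action product `Y ⋊_φ M`. -/
@[ext]
structure Product : Type max u v where
  val : Y × M
  property : val ∈ φ.carrier

variable {φ}

theorem one_symm (a : Y) : (φ.act 1).symm a = a := by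
  have h : a ∈ (φ.act 1).source := by rw [φ.one_source]; trivial
  have h1 := (φ.act 1).left_inv h
  rwa [φ.one_act] at h1

theorem one_target (a : Y) : a ∈ (φ.act 1).target := by
  have h : a ∈ (φ.act 1).source := by rw [φ.one_source]; trivial
  have h1 := (φ.act 1).map_source h
  rwa [φ.one_act] at h1

theorem map_inf (m : M) {a b : Y} (ha : a ∈ (φ.act m).source) (hb : b ∈ (φ.act m).source) :
    φ.act m (a ⊓ b) = φ.act m a ⊓ φ.act m b := by
  have hab := φ.isLowerSet_source m inf_le_left ha (a := a) (b := a ⊓ b)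
  apply le_antisymm
  · exact le_inf ((φ.le_iff_le m _ hab _ ha).2 inf_le_left)
      ((φ.le_iff_le m _ hab _ hb).2 inf_le_right)
  · have ht : φ.act m a ⊓ φ.act m b ∈ (φ.act m).target :=
      φ.isLowerSet_target m inf_le_left ((φ.act m).map_source ha)
    have hs := (φ.act m).map_target ht
    rw [← (φ.act m).right_inv ht, φ.le_iff_le m _ hs _ hab]
    refine le_inf ?_ ?_
    · rw [← φ.le_iff_le m _ hs _ ha, (φ.act m).right_inv ht]; exact inf_le_left
    · rw [← φ.le_iff_le m _ hs _ hb, (φ.act m).right_inv ht]; exact inf_le_right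

theorem mul_aux {m n : M} {h : Y} (h1 : h ∈ (φ.act n).source)
    (h2 : φ.act n h ∈ (φ.act m).source) :
    φ.act m (φ.act n h) ∈ (φ.act (m * n)).target ∧
      (φ.act (m * n)).symm (φ.act m (φ.act n h)) = h := by
  have h3 := φ.mul_source m n h h1 h2
  rw [← φ.mul_act m n h h1 h2]
  exact ⟨(φ.act (m * n)).map_source h3, (φ.act (m * n)).left_inv h3⟩

theorem exists_preimage {m n : M} {e f : Y} (he : e ∈ (φ.act m).target)
    (hf : f ∈ (φ.act n).target) :
    ∃ h ∈ (φ.act n).source, φ.act n h = (φ.act m).symm e ⊓ f ∧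
      φ.act n h ∈ (φ.act m).source ∧ h ≤ (φ.act n).symm f := by
  have ht : (φ.act m).symm e ⊓ f ∈ (φ.act n).target := φ.isLowerSet_target n inf_le_right hf
  have hs := (φ.act n).map_target ht
  refine ⟨_, hs, (φ.act n).right_inv ht, ?_, ?_⟩
  · rw [(φ.act n).right_inv ht]
    exact φ.isLowerSet_source m inf_le_left ((φ.act m).map_target he)
  · rw [← φ.le_iff_le n _ hs _ ((φ.act n).map_target hf), (φ.act n).right_inv ht,
      (φ.act n).right_inv hf]
    exact inf_le_right

namespace Product

/-- `(e, m)(f, n) = (φ_m(φ_m⁻¹(e) ∧ f), mn)`. -/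
instance : Mul φ.Product where
  mul p q := ⟨(φ.act p.1.2 ((φ.act p.1.2).symm p.1.1 ⊓ q.1.1), p.1.2 * q.1.2), by
    obtain ⟨h, h1, h2, h3, -⟩ := exists_preimage p.2 q.2
    change φ.act p.1.2 _ ∈ (φ.act (p.1.2 * q.1.2)).target
    rw [← h2]
    exact (mul_aux h1 h3).1⟩

theorem mul_val (p q : φ.Product) :
    (p * q).1 = (φ.act p.1.2 ((φ.act p.1.2).symm p.1.1 ⊓ q.1.1), p.1.2 * q.1.2) := rfl

theorem mul_aux (p q : φ.Product) : ∃ h ∈ (φ.act q.1.2).source,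
    φ.act q.1.2 h = (φ.act p.1.2).symm p.1.1 ⊓ q.1.1 ∧
    φ.act q.1.2 h ∈ (φ.act p.1.2).source ∧ h ≤ (φ.act q.1.2).symm q.1.1 ∧
    (φ.act (p.1.2 * q.1.2)).symm (p * q).1.1 = h := by
  obtain ⟨h, h1, h2, h3, h4⟩ := exists_preimage p.2 q.2
  refine ⟨h, h1, h2, h3, h4, ?_⟩
  rw [mul_val, ← h2]
  exact (PartialAction.mul_aux h1 h3).2

theorem mul_assoc' (p q r : φ.Product) : p * q * r = p * (q * r) := by
  obtain ⟨h, h1, h2, h3, h4, h5⟩ := mul_aux p q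
  refine Product.ext (Prod.ext ?_ (mul_assoc _ _ _))
  have hq := (φ.act q.1.2).map_target q.2
  have hL : (p * q * r).1.1 = φ.act (p.1.2 * q.1.2) (h ⊓ r.1.1) := by
    rw [mul_val]
    change φ.act (p.1.2 * q.1.2) ((φ.act (p.1.2 * q.1.2)).symm (p * q).1.1 ⊓ r.1.1) = _
    rw [h5]
  have hhr : h ⊓ r.1.1 ∈ (φ.act q.1.2).source := φ.isLowerSet_source _ inf_le_left h1
  have hhr' : φ.act q.1.2 (h ⊓ r.1.1) ∈ (φ.act p.1.2).source :=
    φ.isLowerSet_source _ ((φ.le_iff_le _ _ hhr _ h1).2 inf_le_left) h3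
  rw [hL, φ.mul_act _ _ _ hhr hhr']
  change _ = φ.act p.1.2 ((φ.act p.1.2).symm p.1.1 ⊓
    φ.act q.1.2 ((φ.act q.1.2).symm q.1.1 ⊓ r.1.1))
  congr 1
  have hk : (φ.act q.1.2).symm q.1.1 ⊓ r.1.1 ∈ (φ.act q.1.2).source :=
    φ.isLowerSet_source _ inf_le_left hq
  have hkf : φ.act q.1.2 ((φ.act q.1.2).symm q.1.1 ⊓ r.1.1) ≤ q.1.1 := by
    have := (φ.le_iff_le _ _ hk _ hq).2 inf_le_left
    rwa [(φ.act q.1.2).right_inv q.2] at this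
  calc φ.act q.1.2 (h ⊓ r.1.1)
      = φ.act q.1.2 (h ⊓ ((φ.act q.1.2).symm q.1.1 ⊓ r.1.1)) := by
        rw [← inf_assoc, inf_eq_left.2 h4]
    _ = (φ.act p.1.2).symm p.1.1 ⊓ q.1.1 ⊓
          φ.act q.1.2 ((φ.act q.1.2).symm q.1.1 ⊓ r.1.1) := by rw [map_inf _ h1 hk, h2]
    _ = _ := by rw [inf_assoc, inf_eq_right.2 hkf]

variable [OrderTop Y]

/-- The birestriction monoid structure of `Y ⋊_φ M`, where `Y` has a top element: the identity is
`(⊤, 1)`, and `(e, m)^* = (φ_m⁻¹(e), 1)`, `(e, m)^+ = (e, 1)`. -/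
instance : BirestrictionMonoid φ.Product where
  one := ⟨(⊤, 1), one_target _⟩
  rStar p := ⟨((φ.act p.1.2).symm p.1.1, 1), one_target _⟩
  rPlus p := ⟨(p.1.1, 1), one_target _⟩
  mul_assoc := mul_assoc'
  one_mul p := by
    refine Product.ext (Prod.ext ?_ (one_mul p.1.2))
    change φ.act 1 ((φ.act 1).symm ⊤ ⊓ p.1.1) = p.1.1
    rw [φ.one_act, one_symm, top_inf_eq]
  mul_one p := by
    refine Product.ext (Prod.ext ?_ (mul_one p.1.2))
    change φ.act p.1.2 ((φ.act p.1.2).symm p.1.1 ⊓ ⊤) = p.1.1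
    rw [inf_top_eq, (φ.act p.1.2).right_inv p.2]
  mul_rStar p := by
    refine Product.ext (Prod.ext ?_ (mul_one p.1.2))
    change φ.act p.1.2 ((φ.act p.1.2).symm p.1.1 ⊓ (φ.act p.1.2).symm p.1.1) = p.1.1
    rw [inf_idem, (φ.act p.1.2).right_inv p.2]
  rStar_comm p q := by
    refine Product.ext (Prod.ext ?_ rfl)
    change φ.act 1 ((φ.act 1).symm ((φ.act p.1.2).symm p.1.1) ⊓ (φ.act q.1.2).symm q.1.1) =
      φ.act 1 ((φ.act 1).symm ((φ.act q.1.2).symm q.1.1) ⊓ (φ.act p.1.2).symm p.1.1)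
    rw [one_symm, one_symm, inf_comm]
  rStar_mul_rStar p q := by
    refine Product.ext (Prod.ext ?_ (mul_one 1).symm)
    change (φ.act (p.1.2 * 1)).symm
        (φ.act p.1.2 ((φ.act p.1.2).symm p.1.1 ⊓ (φ.act q.1.2).symm q.1.1)) =
      φ.act 1 ((φ.act 1).symm ((φ.act p.1.2).symm p.1.1) ⊓ (φ.act q.1.2).symm q.1.1)
    rw [one_symm, φ.one_act, mul_one, (φ.act p.1.2).left_inv
      (φ.isLowerSet_source _ inf_le_left ((φ.act p.1.2).map_target p.2))]
  rStar_mul p q := by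
    refine Product.ext (Prod.ext ?_ ((one_mul q.1.2).trans (mul_one q.1.2).symm))
    obtain ⟨h, h1, h2, h3, h4, h5⟩ := mul_aux p q
    change φ.act 1 ((φ.act 1).symm ((φ.act p.1.2).symm p.1.1) ⊓ q.1.1) =
      φ.act q.1.2 ((φ.act q.1.2).symm q.1.1 ⊓ (φ.act (p.1.2 * q.1.2)).symm (p * q).1.1)
    rw [h5, inf_eq_right.2 h4, h2, one_symm, φ.one_act]
  rPlus_mul p := by
    refine Product.ext (Prod.ext ?_ (one_mul p.1.2))
    change φ.act 1 ((φ.act 1).symm p.1.1 ⊓ p.1.1) = p.1.1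
    rw [φ.one_act, one_symm, inf_idem]
  rPlus_comm p q := by
    refine Product.ext (Prod.ext ?_ rfl)
    change φ.act 1 ((φ.act 1).symm p.1.1 ⊓ q.1.1) = φ.act 1 ((φ.act 1).symm q.1.1 ⊓ p.1.1)
    rw [one_symm, one_symm, inf_comm]
  rPlus_rPlus_mul p q := Product.ext (Prod.ext rfl (mul_one 1).symm)
  mul_rPlus p q := by
    refine Product.ext (Prod.ext ?_ ((mul_one p.1.2).trans (one_mul p.1.2).symm))
    change φ.act p.1.2 ((φ.act p.1.2).symm p.1.1 ⊓ q.1.1) =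
      φ.act 1 ((φ.act 1).symm (φ.act p.1.2 ((φ.act p.1.2).symm p.1.1 ⊓ q.1.1)) ⊓ p.1.1)
    have hp := (φ.act p.1.2).map_target p.2
    have h := (φ.le_iff_le p.1.2 _ (φ.isLowerSet_source _ inf_le_left hp) _ hp).2
      (inf_le_left (b := q.1.1))
    rw [(φ.act p.1.2).right_inv p.2] at h
    rw [φ.one_act, one_symm, inf_eq_left.2 h]
  rStar_rPlus p := Product.ext (Prod.ext (one_symm _) rfl)
  rPlus_rStar p := rfl

end Product

end PartialAction

/-! ### The partial action of `X*` on `E(ℐ)` -/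

/-- A premorphism from a monoid to a birestriction monoid. -/
structure IsPremorphism {M : Type u} {S : Type v} [Monoid M] [BirestrictionMonoid S]
    (τ : M → S) : Prop where
  map_one : τ 1 = 1
  mul_le : ∀ m n, NatLE (τ m * τ n) (τ (m * n))

section Premorphism

variable {S : Type v} [InverseMonoid S]

theorem Idem.plus_mul_val (s : S) (e : Idem S) : (Idem.plus (s * e.1)).1 = s * e.1 * s⁻¹ := by
  change s * e.1 * (s * e.1)⁻¹ = _
  rw [inverse_mul, idem_inverse_eq e.2, mul_assoc s, ← mul_assoc e.1 e.1, e.2.eq, ← mul_assoc]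

theorem Idem.star_mul_val (s : S) (e : Idem S) : (Idem.star (e.1 * s)).1 = s⁻¹ * e.1 * s := by
  change (e.1 * s)⁻¹ * (e.1 * s) = _
  rw [inverse_mul, idem_inverse_eq e.2, mul_assoc s⁻¹, ← mul_assoc e.1 e.1, e.2.eq, ← mul_assoc]

theorem Idem.plus_mul_mono (s : S) {e f : Idem S} (h : e ≤ f) :
    Idem.plus (s * e.1) ≤ Idem.plus (s * f.1) := by
  rw [Idem.le_iff, Idem.plus_mul_val, Idem.plus_mul_val]
  calc s * e.1 * s⁻¹ * (s * f.1 * s⁻¹) = s * (e.1 * (s⁻¹ * s * f.1)) * s⁻¹ := by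
        simp only [mul_assoc]
    _ = s * (s⁻¹ * s * (e.1 * f.1)) * s⁻¹ := by
        rw [← mul_assoc e.1, idem_comm e.2 (idem_inverse_mul s)]; simp only [mul_assoc]
    _ = s * s⁻¹ * s * e.1 * s⁻¹ := by rw [Idem.le_iff.1 h]; simp only [mul_assoc]
    _ = _ := by rw [mul_inverse_mul]

theorem Idem.star_mul_mono (s : S) {e f : Idem S} (h : e ≤ f) :
    Idem.star (e.1 * s) ≤ Idem.star (f.1 * s) := by
  have h' := Idem.plus_mul_mono s⁻¹ h
  rw [Idem.le_iff, Idem.plus_mul_val, Idem.plus_mul_val, inverse_inv] at h'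
  rwa [Idem.le_iff, Idem.star_mul_val, Idem.star_mul_val]

theorem Idem.plus_mul_le (s : S) (e : Idem S) : Idem.plus (s * e.1) ≤ Idem.plus s := by
  have h := Idem.plus_mul_mono s (le_top : e ≤ ⊤)
  have h1 : s * (⊤ : Idem S).1 = s := mul_one s
  rwa [h1] at h

theorem Idem.star_mul_le (s : S) (e : Idem S) : Idem.star (e.1 * s) ≤ Idem.star s := by
  have h := Idem.star_mul_mono s (le_top : e ≤ ⊤)
  have h1 : (⊤ : Idem S).1 * s = s := one_mul s
  rwa [h1] at h

theorem Idem.star_plus (s : S) {e : Idem S} (h : e ≤ Idem.star s) :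
    Idem.star ((Idem.plus (s * e.1)).1 * s) = e := by
  apply Idem.ext
  have h1 : e.1 * (s⁻¹ * s) = e.1 := h
  have h2 : s⁻¹ * s * e.1 = e.1 := by rw [← idem_comm e.2 (idem_inverse_mul s), h1]
  rw [Idem.star_mul_val, Idem.plus_mul_val]
  calc s⁻¹ * (s * e.1 * s⁻¹) * s = s⁻¹ * s * e.1 * (s⁻¹ * s) := by simp only [mul_assoc]
    _ = e.1 := by rw [h2, h1]

theorem Idem.plus_star (s : S) {e : Idem S} (h : e ≤ Idem.plus s) :
    Idem.plus (s * (Idem.star (e.1 * s)).1) = e := by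
  apply Idem.ext
  have h1 : e.1 * (s * s⁻¹) = e.1 := h
  have h2 : s * s⁻¹ * e.1 = e.1 := by rw [← idem_comm e.2 (idem_mul_inverse s), h1]
  rw [Idem.plus_mul_val, Idem.star_mul_val]
  calc s * (s⁻¹ * e.1 * s) * s⁻¹ = s * s⁻¹ * e.1 * (s * s⁻¹) := by simp only [mul_assoc]
    _ = e.1 := by rw [h2, h1]

variable {M : Type u} [Monoid M]

theorem premorphism_aux {a b c : S} (hc : NatLE (a * b) c) {e : Idem S}
    (h1 : e ≤ Idem.star b) (h2 : Idem.plus (b * e.1) ≤ Idem.star a) :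
    e ≤ Idem.star c ∧ Idem.plus (c * e.1) = Idem.plus (a * (Idem.plus (b * e.1)).1) := by
  have h3 := hc.eq_mul_rStar
  have h4 : e ≤ Idem.star (a * b) := by
    have h := Idem.star_mul_mono b h2
    rw [Idem.star_plus b h1] at h
    have h5 : Idem.star ((Idem.star a).1 * b) = Idem.star (a * b) := by
      apply Idem.ext
      rw [Idem.star_mul_val]
      change b⁻¹ * (a⁻¹ * a) * b = (a * b)⁻¹ * (a * b)
      rw [inverse_mul]; simp only [mul_assoc]
    rwa [h5] at h
  have h6 : c * e.1 = a * b * e.1 := by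
    have h7 : e.1 = rStar (a * b) * e.1 := by
      have h8 : e.1 * rStar (a * b) = e.1 := h4
      exact h8.symm.trans (idem_comm e.2 (idem_inverse_mul (a * b)))
    calc c * e.1 = c * (rStar (a * b) * e.1) := by rw [← h7]
      _ = c * rStar (a * b) * e.1 := (mul_assoc _ _ _).symm
      _ = a * b * e.1 := by rw [← h3]
  refine ⟨?_, ?_⟩
  · obtain ⟨g, ⟨t, rfl⟩, hg⟩ := hc
    have h := Idem.star_mul_le c (Idem.star t)
    have h9 : (Idem.star t).1 * c = a * b := hg.symm
    rw [h9] at h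
    exact h4.trans h
  · rw [h6]
    apply Idem.ext
    rw [Idem.plus_mul_val, Idem.plus_mul_val, Idem.plus_mul_val, inverse_mul]
    simp only [mul_assoc]

/-- The partial action on `E(S)` determined by a premorphism `τ` from `M` to an inverse monoid `S`:
`dom φ_m = {e | e ≤ τ(m)^*}`, `φ_m(e) = (τ(m)e)^+`, and `ran φ_m = {e | e ≤ τ(m)^+}`,
`φ_m⁻¹(e) = (eτ(m))^*`. -/
def IsPremorphism.partialAction {τ : M → S} (hτ : IsPremorphism τ) : PartialAction M (Idem S) where
  act m :=
    { toFun := fun e => Idem.plus (τ m * e.1)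
      invFun := fun e => Idem.star (e.1 * τ m)
      source := {e | e ≤ Idem.star (τ m)}
      target := {e | e ≤ Idem.plus (τ m)}
      map_source' := fun e _ => Idem.plus_mul_le (τ m) e
      map_target' := fun e _ => Idem.star_mul_le (τ m) e
      left_inv' := fun _ h => Idem.star_plus (τ m) h
      right_inv' := fun _ h => Idem.plus_star (τ m) h }
  source_nonempty m := ⟨Idem.star (τ m), le_refl (Idem.star (τ m))⟩
  isLowerSet_source m := fun _ _ hab ha => le_trans hab ha
  isLowerSet_target m := fun _ _ hab ha => le_trans hab ha
  le_iff_le m a ha b hb := by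
    refine ⟨fun h => ?_, fun h => Idem.plus_mul_mono (τ m) h⟩
    have h' := Idem.star_mul_mono (τ m) h
    change Idem.star ((Idem.plus (τ m * a.1)).1 * τ m) ≤
      Idem.star ((Idem.plus (τ m * b.1)).1 * τ m) at h'
    rwa [Idem.star_plus (τ m) ha, Idem.star_plus (τ m) hb] at h'
  one_source := by
    refine Set.eq_univ_of_forall fun e => ?_
    change e.1 * ((τ 1)⁻¹ * τ 1) = e.1
    rw [hτ.map_one, mul_one, idem_inverse_eq IsIdempotentElem.one, mul_one]
  one_act e := by
    apply Idem.ext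
    change τ 1 * e.1 * (τ 1 * e.1)⁻¹ = e.1
    rw [hτ.map_one, one_mul, idem_inverse_eq e.2, e.2.eq]
  mul_source m n _ h1 h2 := (premorphism_aux (hτ.mul_le m n) h1 h2).1
  mul_act m n _ h1 h2 := (premorphism_aux (hτ.mul_le m n) h1 h2).2

end Premorphism

theorem bar_mul_le {X : Type u} : ∀ l k : List X,
    NatLE (bar (FreeMonoid.ofList l) * bar (FreeMonoid.ofList k)) (bar (FreeMonoid.ofList (l ++ k)))
  | [], k => ⟨1, isProj_one, rfl⟩
  | x :: l, [] => by
    refine ⟨1, isProj_one, ?_⟩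
    rw [List.append_nil, one_mul]
    exact mul_one _
  | x :: l, y :: k =>
    natLE_of_eq_mul (isProj_rStar (bar (FreeMonoid.ofList (x :: l)) * bar (FreeMonoid.ofList (y :: k))))
      (InvPres.mk_eq (ITerm.Rel.rel (ImageRel.intro (RelN.word ⟨x, l⟩ ⟨y, k⟩))))

theorem isPremorphism_bar (X : Type u) : IsPremorphism (bar : FreeMonoid X → MonI X) where
  map_one := rfl
  mul_le m n := bar_mul_le (FreeMonoid.toList m) (FreeMonoid.toList n)

/-- The partial action of the free monoid `X*` on the semilattice `E(ℐ)`: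
`φ_u(e) = (ūe)^+` for `e ≤ ū^*`. -/
def actionI (X : Type u) : PartialAction (FreeMonoid X) (Idem (MonI X)) :=
  (isPremorphism_bar X).partialAction

/-- The partial action product `E(ℐ) ⋊ X*`. -/
abbrev ProductI (X : Type u) : Type u := (actionI X).Product

end FBirestr

open FBirestr
open FBirestr.BirestrictionMonoid (rStar rPlus)
open FBirestr.FBirestrictionMonoid (mx)

/-!
The partial action product has `σ`-classes indexed by `X*`: two elements are `σ`-related exactly
when their second components agree, and `(ū^+, u)` is the largest element with second component
`u`. This holds for the partial action of any premorphism into an inverse monoid, and gives the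
`F`-birestriction structure. The universal property of `FFBR(X)` then yields a morphism `f` with
`f x = (x^+, x)`, and it has to be shown bijective.

Surjectivity (`product_generated`). The elements `(ū^+, u)` are in the image, being the maxima of
the classes of words, so it suffices to reach each `(e, 1)`. Every idempotent of `ℐ` is `(s1)^+`
for some `s` in `ℐ`, and the set of `e` with `(e, 1)` in the image is closed under `e ↦ (se)^+` and
`e ↦ (es)^*` when `s` is `x` or `ū`, hence, by induction on a term for `s`, for all `s`.

Injectivity (`munnI_fst_and_wordMax_snd`). An element `a` of an `F`-birestriction monoid is `a^+ 𝔪(a)`.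
The second component `u` of `f a` determines `𝔪(a)`, which is the maximum `𝔪(u)` of the class of the word
`u`. To recover `a^+`, let the Munn representation `munn` send each `s` in `FFBR(X)` to the partial
bijection `p ↦ (sp)^+` of the projections below `s^*` onto those below `s^+`. It is a morphism into
a symmetric inverse monoid and is injective on projections. Since `x = 𝔪(x)x^*` and
`𝔪(u)𝔪(v) ≤ 𝔪(uv)`, the assignment `x ↦ munn x`, `ū ↦ munn 𝔪(u)` respects the defining relations
of `ℐ`, and so extends to a morphism `munnI` on `ℐ`. By induction on terms, `munnI` maps the first
component of `f a` to `munn a^+`, which determines `a^+`.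
-/

namespace FBirestr

open FBirestr.BirestrictionMonoid (mul_rStar rStar_comm rStar_mul_rStar rStar_mul rPlus_mul
  rPlus_comm rPlus_rPlus_mul mul_rPlus rStar_rPlus rPlus_rStar)
open FBirestr.FBirestrictionMonoid (isMax_mx)

/-! ### Consequences of the identities -/

section Birestriction

variable {S : Type u} [BirestrictionMonoid S]

theorem IsProj.rPlus_eq {e : S} (he : IsProj e) : rPlus e = e := by
  obtain ⟨s, rfl⟩ := he
  exact rPlus_rStar s

theorem rStar_mul_mul_rStar (a b : S) : rStar (a * b) * rStar b = rStar (a * b) := by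
  rw [← rStar_mul_rStar, mul_assoc, mul_rStar]

theorem rPlus_mul_rPlus_mul (a b : S) : rPlus a * rPlus (a * b) = rPlus (a * b) := by
  rw [← rPlus_rPlus_mul, ← mul_assoc, rPlus_mul]

theorem rStar_rStar_mul (a b : S) : rStar (rStar a * b) = rStar (a * b) := by
  rw [rStar_mul, rStar_mul_rStar, rStar_comm, rStar_mul_mul_rStar]

theorem rPlus_mul_rPlus (a b : S) : rPlus (a * rPlus b) = rPlus (a * b) := by
  rw [mul_rPlus, rPlus_rPlus_mul, rPlus_comm, rPlus_mul_rPlus_mul]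

theorem rStar_mul_proj (a : S) {p : S} (hp : IsProj p) : rStar (a * p) = rStar a * p := by
  obtain ⟨s, rfl⟩ := hp
  exact rStar_mul_rStar a s

theorem rPlus_proj_mul {p : S} (hp : IsProj p) (a : S) : rPlus (p * a) = p * rPlus a := by
  have h := rPlus_rPlus_mul p a
  rwa [hp.rPlus_eq] at h

end Birestriction

section FBirestriction

variable {S : Type u} [FBirestrictionMonoid S]

theorem mx_eq_mx_of_sigma {a b : S} (h : sigma S a b) : mx a = mx b :=
  (isMax_mx a).unique (isMax_mx b) h

theorem mx_idem (a : S) : mx (mx a) = mx a :=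
  mx_eq_mx_of_sigma ((sigma S).symm (isMax_mx a).1)

theorem mx_eq_one_of_isProj {e : S} (he : IsProj e) : mx e = 1 := by
  have h1 : mx (1 : S) = 1 := by
    have h := mx_mul_rStar (1 : S)
    rwa [isProj_one.rStar_eq, mul_one] at h
  rw [← h1]
  exact mx_eq_mx_of_sigma (sigma_iff.2 ⟨e, he, by rw [he.idem, one_mul]⟩)

theorem mx_mul_mx (a b : S) : mx (mx a * mx b) = mx (a * b) :=
  mx_eq_mx_of_sigma
    ((sigma S).mul ((sigma S).symm (isMax_mx a).1) ((sigma S).symm (isMax_mx b).1))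

theorem rPlus_mul_mx (a : S) : rPlus a * mx a = a := by
  obtain ⟨e, he, h⟩ := (isMax_mx a).2 a ((sigma S).refl a)
  calc rPlus a * mx a = rPlus (e * mx a) * mx a := by rw [← h]
    _ = e * mx a := by rw [rPlus_proj_mul he, mul_assoc, rPlus_mul]
    _ = a := h.symm

theorem eq_of_rPlus_eq_of_mx_eq {a b : S} (h : rPlus a = rPlus b) (h' : mx a = mx b) : a = b := by
  rw [← rPlus_mul_mx a, h, h', rPlus_mul_mx]

end FBirestriction

/-! ### The Munn representation -/

section Munn

theorem pequiv_ext {α : Type u} {f g : α ≃. α} (h : ∀ a b, b ∈ f a ↔ b ∈ g a) : f = g :=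
  PEquiv.ext fun a => Option.ext (h a)

/-- The symmetric inverse monoid on `α`: partial bijections of `α`, where `f * g` is `g`
followed by `f`. -/
instance symmetricInverseMonoid (α : Type u) : InverseMonoid (α ≃. α) where
  mul f g := g.trans f
  one := PEquiv.refl α
  inv f := f.symm
  mul_assoc f g h := (PEquiv.trans_assoc h g f).symm
  one_mul f := PEquiv.trans_refl f
  mul_one f := PEquiv.refl_trans f
  inverse_inv f := f.symm_symm
  inverse_mul f g := PEquiv.symm_trans_rev g f
  mul_inverse_mul f := by
    change f.trans (f.symm.trans f) = f
    classical
    refine pequiv_ext fun a b => ?_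
    simp only [PEquiv.mem_trans, PEquiv.symm_trans_self, PEquiv.mem_ofSet_iff]
    constructor
    · rintro ⟨c, hc, rfl, -⟩
      exact hc
    · intro h
      refine ⟨b, h, rfl, ?_⟩
      change (f.symm b).isSome
      rw [f.mem_iff_mem.2 h]
      rfl
  inverse_comm f g := by
    change (g.symm.trans g).trans (f.symm.trans f) = (f.symm.trans f).trans (g.symm.trans g)
    classical
    refine pequiv_ext fun a b => ?_
    simp only [PEquiv.mem_trans, PEquiv.symm_trans_self, PEquiv.mem_ofSet_iff]
    constructor
    · rintro ⟨_, ⟨rfl, h⟩, rfl, h'⟩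
      exact ⟨_, ⟨rfl, h'⟩, rfl, h⟩
    · rintro ⟨_, ⟨rfl, h⟩, rfl, h'⟩
      exact ⟨_, ⟨rfl, h'⟩, rfl, h⟩

variable {α : Type v} {S : Type u} [BirestrictionMonoid S]

theorem mem_mul_iff (f g : α ≃. α) {a b : α} :
    b ∈ (f * g) a ↔ ∃ c, c ∈ g a ∧ b ∈ f c := PEquiv.mem_trans g f a b

theorem mem_inv_iff (f : α ≃. α) {a b : α} : b ∈ f⁻¹ a ↔ a ∈ f b := f.mem_iff_mem

/-- If `p ≤ s^*` is carried by `s` to `q`, then `q ≤ s^+` is carried back to `p`: both say that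
`sp = qs`. -/
theorem rPlus_mul_eq_and_rStar_mul_eq {s p q : S} (hp : IsProj p) (h : rStar (s * p) = p)
    (h' : rPlus (s * p) = q) :
    rPlus (q * s) = q ∧ rStar (q * s) = p := by
  have h1 : q * s = s * p := by
    have h2 := mul_rPlus s p
    rw [hp.rPlus_eq, h'] at h2
    exact h2.symm
  rw [h1]
  exact ⟨h', h⟩

/-- The converse of `rPlus_mul_eq_and_rStar_mul_eq`. -/
theorem rStar_mul_eq_and_rPlus_mul_eq {s p q : S} (hq : IsProj q) (h : rPlus (q * s) = q)
    (h' : rStar (q * s) = p) :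
    rStar (s * p) = p ∧ rPlus (s * p) = q := by
  have h1 : s * p = q * s := by
    rw [hq.mul_eq, h']
  rw [h1]
  exact ⟨h', h⟩

open Classical in
/-- The Munn representation: `s` is sent to the partial bijection `p ↦ (sp)^+` from the
projections below `s^*` to the projections below `s^+`. For a projection `p`, the condition
`(sp)^* = p` says that `p ≤ s^*`. -/
noncomputable def munn (s : S) : {e : S // IsProj e} ≃. {e : S // IsProj e} where
  toFun p := if rStar (s * p) = p then some ⟨rPlus (s * p), isProj_rPlus _⟩ else none
  invFun q := if rPlus (q * s) = q then some ⟨rStar (q * s), isProj_rStar _⟩ else none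
  inv p q := by
    simp only [Option.ite_none_right_eq_some, Option.some.injEq, Subtype.ext_iff]
    exact ⟨fun h => rStar_mul_eq_and_rPlus_mul_eq q.2 h.1 h.2,
      fun h => rPlus_mul_eq_and_rStar_mul_eq p.2 h.1 h.2⟩

theorem mem_munn {s : S} {p q : {e : S // IsProj e}} :
    q ∈ munn s p ↔ rStar (s * p) = p ∧ rPlus (s * p) = q := by
  classical
  change q ∈ (if rStar (s * p) = p then some ⟨rPlus (s * p), _⟩ else none) ↔ _
  simp only [Option.mem_def, Option.ite_none_right_eq_some, Option.some.injEq, Subtype.ext_iff]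

theorem mem_munn_of_isProj {e : S} (he : IsProj e) {p q : {e : S // IsProj e}} :
    q ∈ munn e p ↔ e * p = p ∧ q = p := by
  rw [mem_munn, (he.mul p.2).rStar_eq, (he.mul p.2).rPlus_eq, Subtype.ext_iff]
  exact ⟨fun h => ⟨h.1, h.2.symm.trans h.1⟩, fun h => ⟨h.1, h.1.trans h.2.symm⟩⟩

theorem munn_mul (s t : S) : munn (s * t) = munn s * munn t := by
  refine pequiv_ext fun p q => ?_
  simp only [mem_mul_iff, mem_munn]
  have hp := p.2
  constructor
  · rintro ⟨h, h'⟩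
    rw [mul_assoc] at h h'
    -- `p = (stp)^* ≤ (tp)^* ≤ p`
    have h1 : rStar (t * p) = p := by
      have h2 := rStar_mul_mul_rStar s (t * p)
      rwa [h, hp.comm (isProj_rStar _), ← rStar_mul_proj _ hp, mul_assoc, hp.idem] at h2
    have h3 : rStar s * (t * p) = t * p := by
      rw [rStar_mul, h, mul_assoc, hp.idem]
    refine ⟨⟨rPlus (t * p), isProj_rPlus _⟩, ⟨h1, rfl⟩, ?_, ?_⟩
    · rw [rStar_mul_proj _ (isProj_rPlus _), ← rPlus_proj_mul (isProj_rStar s), h3]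
    · rw [rPlus_mul_rPlus, h']
  · rintro ⟨r, ⟨h1, hr⟩, h2, h4⟩
    rw [rStar_mul_proj _ r.2, ← hr] at h2
    have h3 : rStar s * (t * p) = t * p := by
      rw [← rPlus_mul (t * p), ← mul_assoc, h2]
    rw [← hr, rPlus_mul_rPlus] at h4
    rw [mul_assoc, ← rStar_rStar_mul, h3]
    exact ⟨h1, h4⟩

theorem munn_one : munn (1 : S) = 1 := by
  refine pequiv_ext fun p q => ?_
  rw [mem_munn_of_isProj isProj_one]
  change _ ↔ q ∈ some p
  simp only [one_mul, true_and, Option.mem_def, Option.some.injEq]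
  exact eq_comm

theorem munn_rStar (s : S) : munn (rStar s) = rStar (munn s) := by
  refine pequiv_ext fun p q => ?_
  rw [rStar_def, mem_mul_iff, mem_munn_of_isProj (isProj_rStar s), ← rStar_mul_proj s p.2]
  constructor
  · rintro ⟨h, rfl⟩
    have h' : (⟨rPlus (s * q), isProj_rPlus _⟩ : {e : S // IsProj e}) ∈ munn s q :=
      mem_munn.2 ⟨h, rfl⟩
    exact ⟨_, h', (mem_inv_iff _).2 h'⟩
  · rintro ⟨r, h, h'⟩
    exact ⟨(mem_munn.1 h).1, (munn s).inj ((mem_inv_iff _).1 h') h⟩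

theorem munn_rPlus (s : S) : munn (rPlus s) = rPlus (munn s) := by
  refine pequiv_ext fun p q => ?_
  rw [rPlus_def, mem_mul_iff, mem_munn_of_isProj (isProj_rPlus s),
    (isProj_rPlus s).comm p.2, ← rPlus_proj_mul p.2 s]
  constructor
  · rintro ⟨h, rfl⟩
    have h' : q ∈ munn s ⟨rStar (q * s), isProj_rStar _⟩ :=
      mem_munn.2 (rStar_mul_eq_and_rPlus_mul_eq q.2 h rfl)
    exact ⟨_, (mem_inv_iff _).2 h', h'⟩
  · rintro ⟨r, h, h'⟩
    have h := mem_munn.1 ((mem_inv_iff _).1 h)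
    have h'' := mem_munn.1 h'
    exact ⟨(rPlus_mul_eq_and_rStar_mul_eq r.2 h.1 h.2).1, Subtype.ext (h''.2.symm.trans h.2)⟩

theorem munn_isHom : IsBirestrictionHom (munn : S → _) where
  map_one := munn_one
  map_mul := munn_mul
  map_rStar := munn_rStar
  map_rPlus := munn_rPlus

/-- The Munn representation separates projections. -/
theorem eq_of_munn_eq {e f : S} (he : IsProj e) (hf : IsProj f) (h : munn e = munn f) : e = f := by
  have key : ∀ {e f : S}, IsProj e → IsProj f → munn e = munn f → f * e = e := by
    intro e f he hf h
    have h1 : (⟨e, he⟩ : {e : S // IsProj e}) ∈ munn e ⟨e, he⟩ :=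
      (mem_munn_of_isProj he).2 ⟨he.idem, rfl⟩
    rw [h] at h1
    exact ((mem_munn_of_isProj hf).1 h1).1
  rw [← key he hf h, hf.comm he, key hf he h.symm]

end Munn

/-! ### Partial action products of premorphisms -/

section PremorphismProduct

variable {M : Type u} [Monoid M] {S : Type v} [InverseMonoid S]

theorem Idem.isProj (e : Idem S) : IsProj e.1 :=
  ⟨e.1, by rw [rStar_def, idem_inverse_eq e.2, e.2.eq]⟩

theorem NatLE.rPlus_mul_eq {s t : S} (h : NatLE s t) : rPlus s * t = s := by
  obtain ⟨e, he, rfl⟩ := h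
  rw [rPlus_proj_mul he, mul_assoc, rPlus_mul]

namespace IsPremorphism

variable {τ : M → S} (hτ : IsPremorphism τ)

theorem product_ext {p q : hτ.partialAction.Product} (h : p.val.1.val = q.val.1.val)
    (h' : p.val.2 = q.val.2) : p = q :=
  PartialAction.Product.ext (Prod.ext (Idem.ext h) h')

theorem product_le (p : hτ.partialAction.Product) :
    p.val.1.val * rPlus (τ p.val.2) = p.val.1.val := p.property

theorem product_mul_fst (p q : hτ.partialAction.Product) :
    (p * q).val.1.val = p.val.1.val * rPlus (τ p.val.2 * q.val.1.val) := by
  have hp := Idem.isProj p.val.1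
  change rPlus (τ p.val.2 * (rStar (p.val.1.val * τ p.val.2) * q.val.1.val)) = _
  rw [← mul_assoc, ← hp.mul_eq, mul_assoc, rPlus_proj_mul hp]

theorem product_mul_snd (p q : hτ.partialAction.Product) : (p * q).val.2 = p.val.2 * q.val.2 :=
  rfl

theorem product_rStar_fst (p : hτ.partialAction.Product) :
    (rStar p).val.1.val = rStar (p.val.1.val * τ p.val.2) := rfl

/-- The projection `(e, 1)` of the partial action product. -/
def proj (e : Idem S) : hτ.partialAction.Product :=
  ⟨(e, 1), PartialAction.one_target (φ := hτ.partialAction) e⟩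

/-- The element `(τ(m)^+, m)` of the partial action product: the largest one with second
component `m`. -/
def maxElt (m : M) : hτ.partialAction.Product :=
  ⟨(Idem.plus (τ m), m), le_refl (Idem.plus (τ m))⟩

theorem isProj_proj (e : Idem S) : IsProj (hτ.proj e) := isProj_rPlus (hτ.proj e)

theorem isProj_iff {p : hτ.partialAction.Product} : IsProj p ↔ p.val.2 = 1 := by
  constructor
  · rintro ⟨s, rfl⟩
    rfl
  · intro h
    have h1 : p = hτ.proj p.val.1 := hτ.product_ext rfl h
    rw [h1]
    exact hτ.isProj_proj _

theorem proj_mul (e : Idem S) (p : hτ.partialAction.Product) :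
    (hτ.proj e * p).val.1.val = e.1 * p.val.1.val := by
  rw [product_mul_fst]
  change e.1 * rPlus (τ 1 * p.val.1.val) = _
  rw [hτ.map_one, one_mul, (Idem.isProj _).rPlus_eq]

theorem maxElt_mul_proj (m : M) (e : Idem S) :
    (hτ.maxElt m * hτ.proj e).val.1.val = rPlus (τ m * e.1) := by
  rw [product_mul_fst]
  exact rPlus_mul_rPlus_mul (τ m) e.1

theorem eq_proj_mul_maxElt (p : hτ.partialAction.Product) :
    p = hτ.proj p.val.1 * hτ.maxElt p.val.2 := by
  refine hτ.product_ext ?_ (one_mul p.val.2).symm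
  rw [proj_mul]
  exact (hτ.product_le p).symm

theorem sigma_iff_snd {p q : hτ.partialAction.Product} :
    sigma hτ.partialAction.Product p q ↔ p.val.2 = q.val.2 := by
  constructor
  · intro h
    obtain ⟨e, he, h⟩ := sigma_iff.1 h
    have h1 := congrArg (fun r => r.val.2) h
    simp only [product_mul_snd, hτ.isProj_iff.1 he, mul_one] at h1
    exact h1
  · intro h
    have key : ∀ r : hτ.partialAction.Product,
        sigma hτ.partialAction.Product r (hτ.maxElt r.val.2) := by
      intro r
      have h1 : sigma hτ.partialAction.Product (hτ.proj r.val.1) 1 :=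
        ConGen.Rel.of _ _ ⟨hτ.isProj_proj _, isProj_one⟩
      have h2 := (sigma _).mul h1 ((sigma _).refl (hτ.maxElt r.val.2))
      rwa [one_mul, ← hτ.eq_proj_mul_maxElt] at h2
    have hq := key q
    rw [← h] at hq
    exact (sigma _).trans (key p) ((sigma _).symm hq)

theorem isMaxOfClass_maxElt (p : hτ.partialAction.Product) :
    IsMaxOfClass p (hτ.maxElt p.val.2) := by
  refine ⟨hτ.sigma_iff_snd.2 rfl, fun q hq => ⟨hτ.proj q.val.1, hτ.isProj_proj _, ?_⟩⟩
  rw [hτ.sigma_iff_snd.1 hq]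
  exact hτ.eq_proj_mul_maxElt q

/-- The partial action product as an `F`-birestriction monoid. -/
@[reducible]
def productFBirestrictionMonoid : FBirestrictionMonoid hτ.partialAction.Product where
  mx p := hτ.maxElt p.val.2
  isMax_mx := hτ.isMaxOfClass_maxElt

end IsPremorphism

end PremorphismProduct

/-! ### Generation of the partial action product -/

section Generation

variable {X : Type u}

theorem gen_eq_bar_mul_rStar (x : X) : gen x = bar (FreeMonoid.of x) * rStar (gen x) :=
  InvPres.mk_eq (ITerm.Rel.rel (ImageRel.intro (RelN.letter x)))

/-- The element `(x^+, x)` of `E(ℐ) ⋊ X*`. -/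
def productGen (x : X) : ProductI X :=
  ⟨(Idem.plus (gen x), FreeMonoid.of x), by
    change rPlus (gen x) * rPlus (bar (FreeMonoid.of x)) = rPlus (gen x)
    rw [rPlus_comm]
    conv_lhs => rw [gen_eq_bar_mul_rStar x]
    rw [rPlus_mul_rPlus_mul, ← gen_eq_bar_mul_rStar]⟩

/-- `E(ℐ) ⋊ X*` is generated by the elements `(x^+, x)`: for every element `s` of `ℐ`, the
projections `(e, 1)` in a subalgebra are closed under the maps `e ↦ (se)^+` and `e ↦ (es)^*`,
and every idempotent `e` of `ℐ` is `(e1)^+`. -/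
theorem product_generated {T : Set (ProductI X)} (h_one : 1 ∈ T)
    (h_mul : ∀ p ∈ T, ∀ q ∈ T, p * q ∈ T) (h_star : ∀ p ∈ T, rStar p ∈ T)
    (h_plus : ∀ p ∈ T, rPlus p ∈ T)
    (h_max : ∀ p ∈ T, (isPremorphism_bar X).maxElt p.val.2 ∈ T)
    (h_gen : ∀ x, productGen x ∈ T) (p : ProductI X) : p ∈ T := by
  set hτ := isPremorphism_bar X
  have h_word : ∀ u : FreeMonoid X, ∃ q ∈ T, q.val.2 = u := by
    intro u
    induction u using FreeMonoid.inductionOn with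
    | one => exact ⟨1, h_one, rfl⟩
    | of x => exact ⟨_, h_gen x, rfl⟩
    | mul u v hu hv =>
      obtain ⟨q, hq, rfl⟩ := hu
      obtain ⟨r, hr, rfl⟩ := hv
      exact ⟨q * r, h_mul q hq r hr, rfl⟩
  have h_bar : ∀ u : FreeMonoid X, hτ.maxElt u ∈ T := by
    intro u
    obtain ⟨q, hq, rfl⟩ := h_word u
    exact h_max q hq
  have h_inf : ∀ e f : Idem (MonI X), hτ.proj e ∈ T → hτ.proj f ∈ T → hτ.proj (e ⊓ f) ∈ T := by
    intro e f he hf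
    have h : hτ.proj (e ⊓ f) = hτ.proj e * hτ.proj f :=
      hτ.product_ext (hτ.proj_mul e (hτ.proj f)).symm (one_mul 1).symm
    rw [h]
    exact h_mul _ he _ hf
  have h_bar_plus : ∀ u e, hτ.proj e ∈ T → hτ.proj (Idem.plus (bar u * e.1)) ∈ T := by
    intro u e he
    have h : hτ.proj (Idem.plus (bar u * e.1)) = rPlus (hτ.maxElt u * hτ.proj e) :=
      hτ.product_ext (hτ.maxElt_mul_proj u e).symm rfl
    rw [h]
    exact h_plus _ (h_mul _ (h_bar u) _ he)
  have h_bar_star : ∀ u e, hτ.proj e ∈ T → hτ.proj (Idem.star (e.1 * bar u)) ∈ T := by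
    intro u e he
    have h : hτ.proj (Idem.star (e.1 * bar u)) = rStar (hτ.proj e * hτ.maxElt u) := by
      refine hτ.product_ext ?_ rfl
      rw [hτ.product_rStar_fst, hτ.proj_mul]
      change rStar (e.1 * bar u) = rStar (e.1 * rPlus (bar u) * bar (1 * u))
      rw [one_mul, mul_assoc, rPlus_mul]
    rw [h]
    exact h_star _ (h_mul _ he _ (h_bar u))
  have h_gen_star : ∀ x : X, hτ.proj (Idem.star (gen x)) ∈ T := by
    intro x
    have h : hτ.proj (Idem.star (gen x)) = rStar (productGen x) := by
      refine hτ.product_ext ?_ rfl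
      change rStar (gen x) = rStar (rPlus (gen x) * bar (FreeMonoid.of x))
      rw [(natLE_of_eq_mul (isProj_rStar _) (gen_eq_bar_mul_rStar x)).rPlus_mul_eq]
    rw [h]
    exact h_star _ (h_gen x)
  have key : ∀ (t : ITerm (ExtGen X)) (e : Idem (MonI X)), hτ.proj e ∈ T →
      hτ.proj (Idem.plus ((InvPres.mk t : MonI X) * e.1)) ∈ T ∧
      hτ.proj (Idem.star (e.1 * (InvPres.mk t : MonI X))) ∈ T := by
    intro t
    induction t with
    | var y =>
      intro e he
      cases y with
      | inl x =>
        have h1 : Idem.plus (gen x * e.1) =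
            Idem.plus (bar (FreeMonoid.of x) * (Idem.star (gen x) ⊓ e).1) := by
          apply Idem.ext
          change rPlus (gen x * e.1) =
            rPlus (bar (FreeMonoid.of x) * (rStar (gen x) * e.1))
          rw [← mul_assoc, ← gen_eq_bar_mul_rStar]
        have h2 : Idem.star (e.1 * gen x) =
            Idem.star (e.1 * bar (FreeMonoid.of x)) ⊓ Idem.star (gen x) := by
          apply Idem.ext
          change rStar (e.1 * gen x) = rStar (e.1 * bar (FreeMonoid.of x)) * rStar (gen x)
          rw [← rStar_mul_rStar, mul_assoc, ← gen_eq_bar_mul_rStar]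
        change hτ.proj (Idem.plus (gen x * e.1)) ∈ T ∧ hτ.proj (Idem.star (e.1 * gen x)) ∈ T
        rw [h1, h2]
        exact ⟨h_bar_plus _ _ (h_inf _ _ (h_gen_star x) he),
          h_inf _ _ (h_bar_star _ e he) (h_gen_star x)⟩
      | inr s => exact ⟨h_bar_plus (FreeMonoid.ofList (s.head :: s.tail)) e he,
          h_bar_star (FreeMonoid.ofList (s.head :: s.tail)) e he⟩
    | one =>
      intro e he
      have h1 : Idem.plus ((1 : MonI X) * e.1) = e :=
        Idem.ext (by rw [one_mul]; exact e.isProj.rPlus_eq)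
      have h2 : Idem.star (e.1 * (1 : MonI X)) = e :=
        Idem.ext (by rw [mul_one]; exact e.isProj.rStar_eq)
      change hτ.proj (Idem.plus ((1 : MonI X) * e.1)) ∈ T ∧
        hτ.proj (Idem.star (e.1 * (1 : MonI X))) ∈ T
      rw [h1, h2]
      exact ⟨he, he⟩
    | mul a b iha ihb =>
      intro e he
      set a' : MonI X := InvPres.mk a
      set b' : MonI X := InvPres.mk b
      have h1 : Idem.plus (a' * b' * e.1) = Idem.plus (a' * (Idem.plus (b' * e.1)).1) :=
        Idem.ext (by
          change rPlus (a' * b' * e.1) = rPlus (a' * rPlus (b' * e.1))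
          rw [rPlus_mul_rPlus, mul_assoc])
      have h2 : Idem.star (e.1 * (a' * b')) = Idem.star ((Idem.star (e.1 * a')).1 * b') :=
        Idem.ext (by
          change rStar (e.1 * (a' * b')) = rStar (rStar (e.1 * a') * b')
          rw [rStar_rStar_mul, mul_assoc])
      change hτ.proj (Idem.plus (a' * b' * e.1)) ∈ T ∧
        hτ.proj (Idem.star (e.1 * (a' * b'))) ∈ T
      rw [h1, h2]
      exact ⟨(iha _ (ihb e he).1).1, (ihb _ (iha e he).2).2⟩
    | inv a ih =>
      intro e he
      set a' : MonI X := InvPres.mk a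
      have h1 : Idem.plus (a'⁻¹ * e.1) = Idem.star (e.1 * a') := Idem.ext (by
        rw [Idem.plus_mul_val, Idem.star_mul_val, InverseMonoid.inverse_inv])
      have h2 : Idem.star (e.1 * a'⁻¹) = Idem.plus (a' * e.1) := Idem.ext (by
        rw [Idem.plus_mul_val, Idem.star_mul_val, InverseMonoid.inverse_inv])
      change hτ.proj (Idem.plus (a'⁻¹ * e.1)) ∈ T ∧ hτ.proj (Idem.star (e.1 * a'⁻¹)) ∈ T
      rw [h1, h2]
      exact (ih e he).symm
  have h_proj : ∀ e : Idem (MonI X), hτ.proj e ∈ T := by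
    intro e
    obtain ⟨t, ht⟩ : ∃ t, (InvPres.mk t : MonI X) = e.1 :=
      InvPres.ind (p := fun a => ∃ t, (InvPres.mk t : MonI X) = a) (fun t => ⟨t, rfl⟩) e.1
    have h := (key t ⊤ h_one).1
    rw [ht] at h
    have h1 : Idem.plus (e.1 * (⊤ : Idem (MonI X)).1) = e := Idem.ext (by
      change rPlus (e.1 * 1) = e.1
      rw [mul_one, e.isProj.rPlus_eq])
    rwa [h1] at h
  rw [hτ.eq_proj_mul_maxElt p]
  exact h_mul _ (h_proj _) _ (h_bar _)

end Generation

/-! ### Injectivity and surjectivity -/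

section Separation

variable {X : Type u}

/-- Induction on the construction of an element of `FFBR(X)` from the generators. -/
theorem FFBR.induction {p : FFBR X → Prop} (h_of : ∀ x, p (FFBR.of x)) (h_one : p 1)
    (h_mul : ∀ a b, p a → p b → p (a * b)) (h_star : ∀ a, p a → p (rStar a))
    (h_plus : ∀ a, p a → p (rPlus a)) (h_max : ∀ a, p a → p (mx a)) (a : FFBR X) : p a := by
  induction a using FFBR.ind with | h t =>
  induction t with
  | var x => exact h_of x
  | one => exact h_one
  | mul a b iha ihb => exact h_mul _ _ iha ihb
  | star a ih => exact h_star _ ih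
  | plus a ih => exact h_plus _ ih
  | max a ih => exact h_max _ ih

/-- The maximum element of the `σ`-class of the value in `FFBR(X)` of a word. -/
def wordMax (u : FreeMonoid X) : FFBR X := mx (FreeMonoid.lift FFBR.of u)

theorem wordMax_of (x : X) : wordMax (FreeMonoid.of x) = mx (FFBR.of x) := by
  rw [wordMax, FreeMonoid.lift_eval_of]

theorem wordMax_one : wordMax (1 : FreeMonoid X) = 1 := by
  rw [wordMax, map_one, mx_eq_one_of_isProj isProj_one]

theorem mx_wordMax_mul (u v : FreeMonoid X) : mx (wordMax u * wordMax v) = wordMax (u * v) := by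
  rw [wordMax, wordMax, mx_mul_mx, wordMax, map_mul]

/-- The images of the generators of `ℐ` in the symmetric inverse monoid on the projections of
`FFBR(X)`. -/
noncomputable def munnGen : ExtGen X → {e : FFBR X // IsProj e} ≃. {e : FFBR X // IsProj e}
  | .inl x => munn (FFBR.of x)
  | .inr s => munn (wordMax (FreeMonoid.ofList (s.head :: s.tail)))

theorem munnGen_rel (a b : ITerm (ExtGen X)) (h : ImageRel (RelN X) a b) :
    a.eval munnGen = b.eval munnGen := by
  obtain ⟨h⟩ := h
  rw [BTerm.toITerm_eval, BTerm.toITerm_eval]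
  cases h with
  | letter x =>
    change munn (FFBR.of x) = munn (wordMax (FreeMonoid.of x)) * rStar (munn (FFBR.of x))
    rw [wordMax_of, ← munn_rStar, ← munn_mul, mx_mul_rStar]
  | word s t =>
    set u := FreeMonoid.ofList (s.head :: s.tail)
    set v := FreeMonoid.ofList (t.head :: t.tail)
    change munn (wordMax u) * munn (wordMax v) =
      munn (wordMax (u * v)) * rStar (munn (wordMax u) * munn (wordMax v))
    rw [← munn_mul, ← munn_rStar, ← munn_mul, ← mx_wordMax_mul, mx_mul_rStar]

/-- The morphism from `ℐ` to the symmetric inverse monoid on the projections of `FFBR(X)` that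
sends `x` to the Munn representation of `x` and `ū` to that of `𝔪(u)`. -/
noncomputable def munnI : MonI X → ({e : FFBR X // IsProj e} ≃. {e : FFBR X // IsProj e}) :=
  Quotient.lift (ITerm.eval munnGen) fun _ _ h => ITerm.Rel.eval_eq munnGen_rel h

theorem munnI_isHom : IsBirestrictionHom (munnI (X := X)) where
  map_one := rfl
  map_mul := InvPres.ind fun _ => InvPres.ind fun _ => rfl
  map_rStar := InvPres.ind fun _ => rfl
  map_rPlus := InvPres.ind fun _ => rfl

theorem munnI_bar (u : FreeMonoid X) : munnI (bar u) = munn (wordMax u) := by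
  cases u using FreeMonoid.casesOn with
  | one => rw [wordMax_one, munn_one]; rfl
  | of_mul x u => rfl

/-- The key to injectivity: if a morphism `f` from `FFBR(X)` to `E(ℐ) ⋊ X*` extends
`x ↦ (x^+, x)`, then the second component of `f a` determines `𝔪(a)`, and the image in the
symmetric inverse monoid of its first component is the Munn representation of `a^+`. -/
theorem munnI_fst_and_wordMax_snd {f : FFBR X → ProductI X} (hf : IsBirestrictionHom f)
    (hmx : ∀ a, f (mx a) = (isPremorphism_bar X).maxElt (f a).val.2)
    (hgen : ∀ x, f (FFBR.of x) = productGen x) (a : FFBR X) :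
    munnI (f a).val.1.val = munn (rPlus a) ∧ wordMax (f a).val.2 = mx a := by
  have hI := munnI_isHom (X := X)
  have hM := munn_isHom (S := FFBR X)
  set hτ := isPremorphism_bar X
  induction a using FFBR.induction with
  | h_of x =>
    rw [hgen]
    exact ⟨(hI.map_rPlus (gen x)).trans (hM.map_rPlus (FFBR.of x)).symm, wordMax_of x⟩
  | h_one =>
    rw [hf.map_one, isProj_one.rPlus_eq, mx_eq_one_of_isProj isProj_one, munn_one]
    exact ⟨hI.map_one, wordMax_one⟩
  | h_mul a b iha ihb =>
    rw [hf.map_mul]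
    constructor
    · refine (congrArg munnI (hτ.product_mul_fst (f a) (f b))).trans ?_
      -- It remains to see that `a^+ (𝔪(a) b^+)^+ = (a^+ 𝔪(a) b)^+ = (ab)^+`.
      rw [hI.map_mul, hI.map_rPlus, hI.map_mul, munnI_bar, iha.1, iha.2,
        ihb.1, ← hM.map_mul, ← hM.map_rPlus, ← hM.map_mul, rPlus_mul_rPlus, ← rPlus_rPlus_mul,
        ← mul_assoc, rPlus_mul_mx]
    · change wordMax ((f a).val.2 * (f b).val.2) = _
      rw [← mx_wordMax_mul, iha.2, ihb.2, mx_mul_mx]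
  | h_star a ih =>
    rw [hf.map_rStar]
    constructor
    · change munnI (rStar ((f a).val.1.val * bar (f a).val.2)) = _
      rw [hI.map_rStar, hI.map_mul, munnI_bar, ih.1, ih.2, ← hM.map_mul,
        ← hM.map_rStar, rPlus_mul_mx, rPlus_rStar]
    · change wordMax 1 = _
      rw [wordMax_one, mx_eq_one_of_isProj (isProj_rStar a)]
  | h_plus a ih =>
    rw [hf.map_rPlus]
    constructor
    · change munnI (f a).val.1.val = _
      rw [ih.1, (isProj_rPlus a).rPlus_eq]
    · change wordMax 1 = _
      rw [wordMax_one, mx_eq_one_of_isProj (isProj_rPlus a)]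
  | h_max a ih =>
    rw [hmx]
    constructor
    · change munnI (rPlus (bar (f a).val.2)) = _
      rw [hI.map_rPlus, munnI_bar, ih.2, hM.map_rPlus]
    · exact ih.2.trans (mx_idem a).symm

theorem injective_of_map_gen {f : FFBR X → ProductI X} (hf : IsBirestrictionHom f)
    (hmx : ∀ a, f (mx a) = (isPremorphism_bar X).maxElt (f a).val.2)
    (hgen : ∀ x, f (FFBR.of x) = productGen x) : Function.Injective f := by
  intro a b hab
  have ha := munnI_fst_and_wordMax_snd hf hmx hgen a
  rw [hab] at ha
  have hb := munnI_fst_and_wordMax_snd hf hmx hgen b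
  exact eq_of_rPlus_eq_of_mx_eq
    (eq_of_munn_eq (isProj_rPlus a) (isProj_rPlus b) (ha.1.symm.trans hb.1)) (ha.2.symm.trans hb.2)

theorem surjective_of_map_gen {f : FFBR X → ProductI X} (hf : IsBirestrictionHom f)
    (hmx : ∀ a, f (mx a) = (isPremorphism_bar X).maxElt (f a).val.2)
    (hgen : ∀ x, f (FFBR.of x) = productGen x) : Function.Surjective f := by
  refine product_generated (T := Set.range f) ⟨1, hf.map_one⟩ ?_ ?_ ?_ ?_ fun x => ⟨_, hgen x⟩
  · rintro _ ⟨a, rfl⟩ _ ⟨b, rfl⟩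
    exact ⟨a * b, hf.map_mul a b⟩
  · rintro _ ⟨a, rfl⟩
    exact ⟨rStar a, hf.map_rStar a⟩
  · rintro _ ⟨a, rfl⟩
    exact ⟨rPlus a, hf.map_rPlus a⟩
  · rintro _ ⟨a, rfl⟩
    exact ⟨mx a, hmx a⟩

end Separation

end FBirestr

theorem mainTheorem2 (X : Type u) [Nonempty X] :
    -- the underlying set `{(e, u) | e ≤ ū^+}` of `E(ℐ) ⋊ X*`
    (actionI X).carrier = {p : Idem (MonI X) × FreeMonoid X | p.1 ≤ Idem.plus (bar p.2)} ∧
    -- the identity element `(1, 1)`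
    ((1 : ProductI X).val.1.val = 1 ∧ (1 : ProductI X).val.2 = 1) ∧
    -- `(e, u)(f, v) = (e(ūf)^+, uv)`
    (∀ p q : ProductI X,
      (p * q).val.1.val = p.val.1.val * rPlus (bar p.val.2 * q.val.1.val) ∧
      (p * q).val.2 = p.val.2 * q.val.2) ∧
    -- `(e, u)^* = ((eū)^*, 1)`
    (∀ p : ProductI X,
      (rStar p).val.1.val = rStar (p.val.1.val * bar p.val.2) ∧ (rStar p).val.2 = 1) ∧
    -- `(e, u)^+ = (e, 1)`
    (∀ p : ProductI X, (rPlus p).val.1.val = p.val.1.val ∧ (rPlus p).val.2 = 1) ∧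
    -- `E(ℐ) ⋊ X*` is `F`-birestriction
    ∃ hF : IsFBirestriction (ProductI X),
      -- `mx (e, u) = (ū^+, u)`
      (∀ p : ProductI X,
        (hF.max p).val.1.val = rPlus (bar p.val.2) ∧ (hF.max p).val.2 = p.val.2) ∧
      -- `x ↦ (x^+, x)` extends to an isomorphism
      ∃ f : FFBR X → ProductI X, Function.Bijective f ∧ IsBirestrictionHom f ∧
        (∀ a, f (mx a) = hF.max (f a)) ∧
        ∀ x : X, (f (FFBR.of x)).val.1.val = rPlus (gen x) ∧
          (f (FFBR.of x)).val.2 = FreeMonoid.of x := by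
  have hτ := isPremorphism_bar X
  have hF : IsFBirestriction (ProductI X) := fun p => ⟨_, hτ.isMaxOfClass_maxElt p⟩
  have hF_max : ∀ p, hF.max p = hτ.maxElt p.val.2 := fun p =>
    (hF p).choose_spec.unique (hτ.isMaxOfClass_maxElt p) ((sigma _).refl p)
  let _ : FBirestrictionMonoid (ProductI X) := hτ.productFBirestrictionMonoid
  obtain ⟨f, ⟨hf, hmx, hgen⟩, -⟩ := FFBR.existsUnique_lift (S := ProductI X) productGen
  refine ⟨rfl, ⟨rfl, rfl⟩, fun p q => ⟨hτ.product_mul_fst p q, rfl⟩, fun p => ⟨rfl, rfl⟩,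
    fun p => ⟨rfl, rfl⟩, hF, fun p => ?_, f,
    ⟨injective_of_map_gen hf hmx hgen, surjective_of_map_gen hf hmx hgen⟩, hf,
    fun a => (hmx a).trans (hF_max (f a)).symm, fun x => ?_⟩
  · rw [hF_max]
    exact ⟨rfl, rfl⟩
  · rw [hgen]
    exact ⟨rfl, rfl⟩
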